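/- **Setting.** For a finite-dimensional Hilbert space $C$, an encoding $f$ of $\{0,1\}^n$ into density operators on $C$, together with two-outcome measurements $\{M^y,\mathbb 1-M^y\}$ ($0\le M^y\le \mathbb 1$) for $y\in\{0,1\}^n$, is a *$(\delta,\epsilon)$-hiding fingerprint* if 1. (fingerprint property) $\mathrm{tr}[M^xf(x)]=1$ for all $x$, and $\mathrm{tr}[M^yf(x)]\le\delta$ for all $y\ne x$; 2. (hiding property) if $X$ is uniform on $\{0,1\}^n$, then for every POVM $\{N_i\}$ on $C$, with outcome $I$ on the state $f(X)$, and for every outcome $i$ of nonzero probability, $\frac12\sum_x\bigl|\Pr[X=x\mid I=i]-2^{-n}\bigr|\le\epsilon$. *The scheme.* Let $\log$ denote the logarithm to base $2$. Given constants $c,c',c''>0$, a positive integer $n$ and $\delta,\epsilon\in(0,1/4)$, put $$l=\Bigl(\frac{c''}{\delta}\cdot\frac{\log^2(1/\epsilon)}{\epsilon^8}\Bigr)^{1/0.9}+10n,\qquad u=l+\Bigl(\frac{n}{2\delta}\Bigr)^2,$$ let $\mathcal P$ be the set of primes in $[l,u]$, and let $t=\lceil c\log(1/\epsilon)\epsilon^{-2}\rceil$,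 $d_B=\lceil c'/\epsilon^2\rceil$. For each $p\in\mathcal P$ let $U^p_0,\dots,U^p_{t-1}$ be unitaries on $\mathbb C^p\otimes\mathbb C^{d_B}$, all of them independent and Haar distributed. The fingerprint of $x$ (an $n$-bit string, read as an integer in $\{0,\dots,2^n-1\}$) consists of a uniformly random $p\in\mathcal P$ together with the state $(U^p_k)^\dagger|x\bmod p\rangle|b\rangle$ for uniform independent $k\in\{0,\dots,t-1\}$, $b\in\{0,\dots,d_B-1\}$. That is, on $C=\bigoplus_{p\in\mathcal P}\mathbb C^p\otimes\mathbb C^{d_B}$, $$f(x)=\frac1{|\mathcal P|}\bigoplus_{p\in\mathcal P}\ \frac1{t\,d_B}\sum_{k,b}(U^p_k)^\dagger\bigl(|x\bmod p\rangle\langle x\bmod p|\otimes|b\rangle\langle b|\bigr)U^p_k .$$ The scheme *succeeds* for a choice of the unitaries if there are measurements $\{M^y,\mathbb 1-M^y\}$ with which $f$ is a $(\delta,\epsilon)$-hiding fingerprint. **Theorem.** There are universal constants $c,c',c'',\kappa>0$ such that: * for all positive integers $n$ and all $\delta,\epsilon\in(0,1/4)$ such that $u\le2^{n-2}$, and such that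 $|\mathcal P|\ge n/(2\delta)$ or $l\le(n/2\delta)^2$, the scheme succeeds with probability at least $1-2^{-\kappa n}$ over the choice of the unitaries; * for all $\delta,\epsilon\in(0,1/4)$ and all sufficiently large $n$ (depending on $\delta,\epsilon$), $u\le 2^{n-2}$, $|\mathcal P|\ge n/(2\delta)$, and the scheme succeeds with probability at least $1-2^{-\kappa n}$. -/

import Mathlib

open MeasureTheory
open scoped Matrix ComplexOrder

noncomputable section

namespace HidingFingerprint

/-! ### Haar measure on the unitary group -/

section Haar

variable (ι : Type) [Fintype ι] [DecidableEq ι]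

instance unitaryMeasurableSpace : MeasurableSpace (Matrix.unitaryGroup ι ℂ) := borel _

instance unitaryBorelSpace : BorelSpace (Matrix.unitaryGroup ι ℂ) := ⟨rfl⟩

instance unitaryCompactSpace : CompactSpace (Matrix.unitaryGroup ι ℂ) := by
  refine isCompact_iff_compactSpace.mp (?_ : IsCompact (Matrix.unitaryGroup ι ℂ : Set (Matrix ι ι ℂ)))
  have hK : IsCompact (Set.pi Set.univ
      (fun _ : ι => Set.pi Set.univ (fun _ : ι => Metric.closedBall (0 : ℂ) 1))) :=
    isCompact_univ_pi fun _ => isCompact_univ_pi fun _ => isCompact_closedBall 0 1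
  have hc : IsClosed {U : Matrix ι ι ℂ | star U * U = 1 ∧ U * star U = 1} := by
    apply IsClosed.inter
    · exact isClosed_eq (continuous_star.mul continuous_id) continuous_const
    · exact isClosed_eq (continuous_id.mul continuous_star) continuous_const
  refine IsCompact.of_isClosed_subset hK hc ?_
  intro U hU i _ j _
  rw [mem_closedBall_zero_iff]
  exact entry_norm_bound_of_unitary (Unitary.mem_iff.mpr hU) i j

/-- The normalized Haar measure on the unitary group, i.e. the law of a random unitary. -/
def haarUnitary : Measure (Matrix.unitaryGroup ι ℂ) :=
  Measure.haarMeasure (⊤ : TopologicalSpace.PositiveCompacts (Matrix.unitaryGroup ι ℂ))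

instance haarUnitary_isProbabilityMeasure : IsProbabilityMeasure (haarUnitary ι) :=
  ⟨Measure.haarMeasure_self (K₀ := (⊤ : TopologicalSpace.PositiveCompacts
    (Matrix.unitaryGroup ι ℂ)))⟩

instance haarUnitary_isHaarMeasure : (haarUnitary ι).IsHaarMeasure := by
  unfold haarUnitary; infer_instance

end Haar

/-! ### Quantum states, measurements and hiding fingerprints

A finite-dimensional Hilbert space is given by a finite type `κ` that labels its computational
basis, and operators on it are matrices indexed by `κ`.  An `n`-bit string is identified with the
integer in `[2 ^ n]` that it represents in binary. -/

section Fingerprint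

variable {κ : Type} [Fintype κ] [DecidableEq κ]

/-- Density operators. -/
structure IsDensityOperator (ρ : Matrix κ κ ℂ) : Prop where
  posSemidef : ρ.PosSemidef
  trace_eq_one : ρ.trace = 1

/-- `{M, 1 - M}` is a two-outcome measurement. -/
structure IsBinaryMeasurement (M : Matrix κ κ ℂ) : Prop where
  posSemidef : M.PosSemidef
  compl_posSemidef : (1 - M).PosSemidef

/-- The family `N` is a POVM. -/
structure IsPOVM {ι : Type} [Fintype ι] (N : ι → Matrix κ κ ℂ) : Prop where
  posSemidef : ∀ i, (N i).PosSemidef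
  sum_eq_one : ∑ i, N i = 1

/-- The probability of the outcome with POVM element `E` on the state `ρ`, that is `tr (E ρ)`. -/
def outcomeProb (E ρ : Matrix κ κ ℂ) : ℝ := (E * ρ).trace.re

/-- Total variation (trace) distance between two distributions on a finite set. -/
def traceDist {α : Type} [Fintype α] (p q : α → ℝ) : ℝ := (1 / 2) * ∑ x, |p x - q x|

/-- The uniform distribution on the `n`-bit strings. -/
def unifBits (n : ℕ) : Fin (2 ^ n) → ℝ := fun _ => 1 / 2 ^ n

/-- The probability of the outcome with POVM element `E` when the state `f X` is measured, where
`X` is a uniformly random `n`-bit string. -/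
def avgOutcomeProb {n : ℕ} (f : Fin (2 ^ n) → Matrix κ κ ℂ) (E : Matrix κ κ ℂ) : ℝ :=
  ∑ x, unifBits n x * outcomeProb E (f x)

/-- The distribution of a uniformly random `n`-bit string `X` conditioned on the outcome with
POVM element `E` in a measurement of the state `f X` (Bayes' rule). -/
def posterior {n : ℕ} (f : Fin (2 ^ n) → Matrix κ κ ℂ) (E : Matrix κ κ ℂ) : Fin (2 ^ n) → ℝ :=
  fun x => unifBits n x * outcomeProb E (f x) / avgOutcomeProb f E

/-- `(δ, ε)`-hiding fingerprints: the encoding `f` together with the measurements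
`{M y, 1 - M y}`.  Conditioning is only meaningful on outcomes of nonzero probability. -/
structure IsHidingFingerprint (n : ℕ) (δ ε : ℝ)
    (f : Fin (2 ^ n) → Matrix κ κ ℂ) (M : Fin (2 ^ n) → Matrix κ κ ℂ) : Prop where
  density : ∀ x, IsDensityOperator (f x)
  measurement : ∀ y, IsBinaryMeasurement (M y)
  accept : ∀ x, outcomeProb (M x) (f x) = 1
  reject : ∀ x y, y ≠ x → outcomeProb (M y) (f x) ≤ δ
  hides : ∀ (ι : Type) [Fintype ι] (N : ι → Matrix κ κ ℂ), IsPOVM N →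
    ∀ i, avgOutcomeProb f (N i) ≠ 0 → traceDist (posterior f (N i)) (unifBits n) ≤ ε

end Fingerprint

/-! ### The scheme -/

/-- The left end `(c'' / δ * log² (1/ε) / ε⁸) ^ (1/0.9) + 10 n`; logarithms are to base two. -/
def lowerEnd (c'' : ℝ) (n : ℕ) (δ ε : ℝ) : ℝ :=
  (c'' / δ * (Real.logb 2 (1 / ε) ^ 2 / ε ^ 8)) ^ (1 / 0.9 : ℝ) + 10 * n

/-- The right end of the interval. -/
def upperEnd (c'' : ℝ) (n : ℕ) (δ ε : ℝ) : ℝ := lowerEnd c'' n δ ε + (n / (2 * δ)) ^ 2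

/-- The primes in the real interval `[l, u]`. -/
def primesBetween (l u : ℝ) : Finset ℕ :=
  (Finset.range (⌊u⌋₊ + 1)).filter fun p => p.Prime ∧ l ≤ p ∧ (p : ℝ) ≤ u

/-- The primes `p` from which the scheme chooses. -/
def schemePrimes (c'' : ℝ) (n : ℕ) (δ ε : ℝ) : Finset ℕ :=
  primesBetween (lowerEnd c'' n δ ε) (upperEnd c'' n δ ε)

/-- The number `t = ⌈c log (1/ε) ε⁻²⌉` of unitaries. -/
def numUnitaries (c ε : ℝ) : ℕ := ⌈c * Real.logb 2 (1 / ε) / ε ^ 2⌉₊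

/-- The dimension `⌈c' / ε²⌉` of the system `B`. -/
def dimB (c' ε : ℝ) : ℕ := ⌈c' / ε ^ 2⌉₊

/-- Labels of the computational basis of `A ⊗ B` with `dim A = p` and `dim B = dB`. -/
abbrev BasisAB (p dB : ℕ) : Type := Fin p × Fin dB

/-- Labels of the computational basis of the system `C` that holds the prime `p ∈ P` (a classical
register) and a state of the corresponding `A ⊗ B`: `C` is the direct sum of these spaces. -/
abbrev BasisC (P : Finset ℕ) (dB : ℕ) : Type := Σ p : P, BasisAB p.1 dB

/-- A choice of unitaries `U p 0, …, U p (t - 1)` for all `p ∈ P`. -/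
abbrev UnitaryFamily (P : Finset ℕ) (t dB : ℕ) : Type :=
  (p : P) → Fin t → Matrix.unitaryGroup (BasisAB p.1 dB) ℂ

/-- The law of the random unitaries: all of them are independent and Haar distributed. -/
def unitaryLaw (P : Finset ℕ) (t dB : ℕ) : Measure (UnitaryFamily P t dB) :=
  Measure.pi fun p : P => Measure.pi fun _ : Fin t => haarUnitary (BasisAB p.1 dB)

/-- For a fixed `p`, the locked state
`1 / (t dB) ∑ₖ ∑ᵦ Uₖ† (|x mod p⟩⟨x mod p| ⊗ |b⟩⟨b|) Uₖ` on `A ⊗ B`.  The entry of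
`|a⟩⟨a|` at `(i, j)` is `1` if `i = a` and `j = a`, and `0` otherwise. -/
def lockedState (p t dB : ℕ) (U : Fin t → Matrix.unitaryGroup (BasisAB p dB) ℂ) (x : ℕ) :
    Matrix (BasisAB p dB) (BasisAB p dB) ℂ :=
  (1 / ((t : ℂ) * (dB : ℂ))) • ∑ k : Fin t, ∑ b : Fin dB,
    (U k : Matrix (BasisAB p dB) (BasisAB p dB) ℂ)ᴴ *
      Matrix.of (fun i j : BasisAB p dB =>
        if (i.1.val = x % p ∧ i.2 = b) ∧ (j.1.val = x % p ∧ j.2 = b) then (1 : ℂ) else 0) *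
      (U k : Matrix (BasisAB p dB) (BasisAB p dB) ℂ)

/-- The fingerprint of `x`: a uniformly random prime `p ∈ P` together with the locked state. -/
def fingerprint {n : ℕ} (P : Finset ℕ) (t dB : ℕ) (U : UnitaryFamily P t dB) (x : Fin (2 ^ n)) :
    Matrix (BasisC P dB) (BasisC P dB) ℂ :=
  (1 / (P.card : ℂ)) • Matrix.blockDiagonal' fun p : P => lockedState p.1 t dB (U p) x.val

/-- The choices of unitaries for which the encoding `fingerprint` is, with suitable measurements, a
`(δ, ε)`-hiding fingerprint. -/
def goodUnitaries (n : ℕ) (δ ε : ℝ) (P : Finset ℕ) (t dB : ℕ) : Set (UnitaryFamily P t dB) :=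
  {U | ∃ M : Fin (2 ^ n) → Matrix (BasisC P dB) (BasisC P dB) ℂ,
    IsHidingFingerprint n δ ε (fingerprint P t dB U) M}

/-- The probability that the scheme fails to be a `(δ, ε)`-hiding fingerprint. -/
def failureProb (c c' c'' : ℝ) (n : ℕ) (δ ε : ℝ) : ENNReal :=
  unitaryLaw (schemePrimes c'' n δ ε) (numUnitaries c ε) (dimB c' ε)
    (goodUnitaries n δ ε (schemePrimes c'' n δ ε) (numUnitaries c ε) (dimB c' ε))ᶜ

end HidingFingerprint

end

noncomputable section

namespace HidingFingerprint

open ProbabilityTheory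

/-! ### Haar measure on the unitary group: invariance -/

section HaarInvariance

variable {ι : Type} [Fintype ι] [DecidableEq ι]

/-! The test for `y` is, in each block `p`, the projection onto the support of the locked state of
`y`. It accepts `y` with certainty, so the work is in soundness and hiding. Each holds outside an
event of exponentially small probability, and union bounds combine them
(`measure_compl_goodUnitaries_le`).

Soundness. If `x ≠ y`, the product of the primes of `P` modulo which they agree divides `|x - y| < 2
^ n`. As all these primes are at least `2 ^ 8`, there are at most `n / 8` of them
(`card_primes_mod_eq_le`), and they cost at most `δ / 4` once `|P| ≥ n / (2δ)`. For any other `p`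
the acceptance probability lies in `[0, 1]` and has mean at most `t / (p - 1)`
(`integral_overlap_le`): the locked states of the `p` labels add up to a multiple of the identity
and a support has rank at most `t dB`, so the overlaps with a fixed support add up to at most `t`,
and permuting labels shows that the `p - 1` overlaps with the other labels have equal means. These
variables are independent over `p`, so the Chernoff bound `measure_sum_ge_le` beats the union over
`4 ^ n` pairs.

Hiding. For a POVM element `E`, what matters is `∑ₐ |tr E ρₐ - tr E / (p dB)|` over the labels `a`.
Choosing the signs `s` of the summands turns it into a pairing of `E` with the average over `k` of
`Uₖ† D Uₖ`, where `D` is the centred diagonal matrix of `s`. It therefore suffices that these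
averages have norm at most `ε / 4` for all `2 ^ p` sign patterns (`locksWell_of_signPatterns`). For
one unit vector the quadratic form has a subgaussian tail with exponent proportional to `t` times
the dimension (`measure_avg_diagForm_ge_le`), which pays for a net of the sphere and for all sign
patterns. The Laplace transform behind the tail is compared with that of a Gaussian vector by
Jensen's inequality (`integral_haar_exp_le_prod`). Passing from labels to strings loses a factor 2,
since residues modulo `p ≤ 2 ^ n` are nearly equidistributed, and normalizing the posterior accounts
for the rest (`hides_of_locksWell`).

The alternative hypothesis `l ≤ (n / 2δ) ^ 2` gives enough primes by an Erdős-type estimate of the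
central binomial coefficient (`sqrt_le_card_primesBetween`). -/

instance unitarySecondCountable : SecondCountableTopology (Matrix.unitaryGroup ι ℂ) :=
  haveI : SecondCountableTopology (Matrix ι ι ℂ) :=
    inferInstanceAs (SecondCountableTopology (ι → ι → ℂ))
  TopologicalSpace.Subtype.secondCountableTopology (Matrix.unitaryGroup ι ℂ : Set (Matrix ι ι ℂ))

/-- A right translate of the Haar probability measure is again a left Haar probability measure, and
there is only one. -/
instance haarUnitary_isMulRightInvariant : (haarUnitary ι).IsMulRightInvariant := by
  constructor
  intro V
  have : IsProbabilityMeasure ((haarUnitary ι).map (fun U => U * V)) :=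
    Measure.isProbabilityMeasure_map (measurable_mul_const V).aemeasurable
  exact Measure.isHaarMeasure_eq_of_isProbabilityMeasure _ _

/-- The entries of a unitary matrix depend continuously on it. -/
lemma continuous_unitary_coe :
    Continuous (fun U : Matrix.unitaryGroup ι ℂ => (U : Matrix ι ι ℂ)) := continuous_subtype_val

lemma exists_unitary_mulVec_single (i₀ : ι) (ψ : ι → ℂ) (hψ : ∑ i, ‖ψ i‖ ^ 2 = 1) :
    ∃ W : Matrix.unitaryGroup ι ℂ, (W : Matrix ι ι ℂ) *ᵥ Pi.single i₀ 1 = ψ := by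
  have hn : ‖(WithLp.toLp 2 ψ : EuclideanSpace ℂ ι)‖ = 1 := by
    rw [EuclideanSpace.norm_eq]; simp [hψ]
  have ho : Orthonormal ℂ (({i₀} : Set ι).domRestrict
      (fun _ : ι => (WithLp.toLp 2 ψ : EuclideanSpace ℂ ι))) := by
    constructor
    · intro i; simpa using hn
    · intro i j hij
      exact absurd (Subsingleton.elim i j) hij
  obtain ⟨b, hb⟩ := ho.exists_orthonormalBasis_extension_of_card_eq (by simp)
  refine ⟨⟨(EuclideanSpace.basisFun ι ℂ).toBasis.toMatrix b,
    (EuclideanSpace.basisFun ι ℂ).toMatrix_orthonormalBasis_mem_unitary b⟩, ?_⟩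
  ext i
  have := hb i₀ rfl
  simp [Module.Basis.toMatrix_apply, this]

/-- Right invariance absorbs a unitary that carries the basis vector to `ψ`. Hence the law of `U ψ`
is the same for all unit vectors. -/
lemma integral_haar_mulVec_eq (i₀ : ι) (ψ : ι → ℂ) (hψ : ∑ i, ‖ψ i‖ ^ 2 = 1)
    (F : (ι → ℂ) → ℝ) :
    ∫ U : Matrix.unitaryGroup ι ℂ, F ((U : Matrix ι ι ℂ) *ᵥ ψ) ∂haarUnitary ι =
      ∫ U : Matrix.unitaryGroup ι ℂ, F ((U : Matrix ι ι ℂ) *ᵥ Pi.single i₀ 1) ∂haarUnitary ι := by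
  obtain ⟨W, hW⟩ := exists_unitary_mulVec_single i₀ ψ hψ
  rw [← integral_mul_right_eq_self
    (fun U : Matrix.unitaryGroup ι ℂ => F ((U : Matrix ι ι ℂ) *ᵥ Pi.single i₀ 1)) W]
  simp only [Submonoid.coe_mul, ← Matrix.mulVec_mulVec, hW]

lemma sum_norm_sq_unitary_mulVec (U : Matrix.unitaryGroup ι ℂ) (z : ι → ℂ) :
    ∑ i, ‖((U : Matrix ι ι ℂ) *ᵥ z) i‖ ^ 2 = ∑ i, ‖z i‖ ^ 2 := by
  have h1 : ∀ w : ι → ℂ, ((∑ i, ‖w i‖ ^ 2 : ℝ) : ℂ) = star w ⬝ᵥ w := by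
    intro w
    simp [dotProduct, ← Complex.normSq_eq_norm_sq, Complex.normSq_eq_conj_mul_self]
  have h2 : star ((U : Matrix ι ι ℂ) *ᵥ z) ⬝ᵥ ((U : Matrix ι ι ℂ) *ᵥ z) = star z ⬝ᵥ z := by
    rw [Matrix.star_mulVec, Matrix.dotProduct_mulVec, Matrix.vecMul_vecMul,
      ← Matrix.star_eq_conjTranspose, Unitary.coe_star_mul_self, Matrix.vecMul_one]
  exact_mod_cast (h1 _).trans (h2.trans (h1 z).symm)

end HaarInvariance

/-! ### Complex Gaussian vectors -/

section Gaussian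

lemma integrable_exp_mul_sq_gaussianReal {a : ℝ} (ha : a < 1 / 2) :
    Integrable (fun x : ℝ => Real.exp (a * x ^ 2)) (gaussianReal 0 1) := by
  have h : Integrable (fun x : ℝ => gaussianPDFReal 0 1 x • Real.exp (a * x ^ 2)) := by
    have h2 := (integrable_exp_neg_mul_sq (b := 1 / 2 - a) (by linarith)).const_mul
      (√(2 * Real.pi * (1 : NNReal)))⁻¹
    refine h2.congr (Filter.Eventually.of_forall fun x => ?_)
    simp only [gaussianPDFReal, smul_eq_mul, mul_assoc, ← Real.exp_add]
    congr 3
    simp; ring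
  rw [gaussianReal_of_var_ne_zero _ one_ne_zero]
  rw [integrable_withDensity_iff_integrable_smul' (measurable_gaussianPDF 0 1)
    (Filter.Eventually.of_forall fun x => gaussianPDF_lt_top)]
  simpa [toReal_gaussianPDF] using h

lemma integral_exp_mul_sq_gaussianReal {a : ℝ} (ha : a < 1 / 2) :
    ∫ x, Real.exp (a * x ^ 2) ∂gaussianReal 0 1 = √(1 / (1 - 2 * a)) := by
  rw [integral_gaussianReal_eq_integral_smul one_ne_zero]
  have h : (fun x : ℝ => gaussianPDFReal 0 1 x • Real.exp (a * x ^ 2)) =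
      fun x => (√(2 * Real.pi))⁻¹ * Real.exp (-(1 / 2 - a) * x ^ 2) := by
    ext x
    simp only [gaussianPDFReal, smul_eq_mul, mul_assoc, ← Real.exp_add]
    simp only [NNReal.coe_one, mul_one, sub_zero]
    ring_nf
  rw [h, integral_const_mul, integral_gaussian, ← Real.sqrt_inv, ← Real.sqrt_mul (by positivity)]
  congr 1
  have : 1 - 2 * a ≠ 0 := by linarith
  have h3 : 1 / 2 - a ≠ 0 := by linarith
  field_simp

lemma integral_sq_gaussianReal : ∫ x, x ^ 2 ∂gaussianReal 0 1 = 1 := by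
  have h := variance_id_gaussianReal (μ := 0) (v := 1)
  rw [variance_eq_integral (by fun_prop)] at h
  simpa using h

/-- The law of the real and imaginary parts of a standard complex Gaussian vector. -/
def gaussianParts (ι : Type) [Fintype ι] : Measure (ι ⊕ ι → ℝ) := Measure.pi fun _ => gaussianReal 0 1

instance gaussianParts_isProbabilityMeasure (ι : Type) [Fintype ι] :
    IsProbabilityMeasure (gaussianParts ι) := by unfold gaussianParts; infer_instance

variable {ι : Type} [Fintype ι] [DecidableEq ι]

/-- The complex vector with given real and imaginary parts. -/
def toComplexVec (x : ι ⊕ ι → ℝ) : ι → ℂ := fun i => ⟨x (.inl i), x (.inr i)⟩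

lemma norm_sq_toComplexVec {ι : Type} (x : ι ⊕ ι → ℝ) (i : ι) :
    ‖toComplexVec x i‖ ^ 2 = x (.inl i) ^ 2 + x (.inr i) ^ 2 := by
  rw [← Complex.normSq_eq_norm_sq, toComplexVec, Complex.normSq_mk]; ring

lemma continuous_toComplexVec {ι : Type} : Continuous (toComplexVec : (ι ⊕ ι → ℝ) → ι → ℂ) := by
  refine continuous_pi fun i => ?_
  have : (fun x : ι ⊕ ι → ℝ => toComplexVec x i) =
      fun x => (x (.inl i) : ℂ) + (x (.inr i) : ℂ) * Complex.I := by
    ext x; simp [toComplexVec, Complex.mk_eq_add_mul_I]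
  rw [this]; fun_prop

/-- The action of a unitary on real and imaginary parts. -/
def realAction (U : Matrix.unitaryGroup ι ℂ) :
    EuclideanSpace ℝ (ι ⊕ ι) →ₗᵢ[ℝ] EuclideanSpace ℝ (ι ⊕ ι) where
  toFun v := WithLp.toLp 2 (Sum.elim
    (fun i => (((U : Matrix ι ι ℂ) *ᵥ toComplexVec v.ofLp) i).re)
    (fun i => (((U : Matrix ι ι ℂ) *ᵥ toComplexVec v.ofLp) i).im))
  map_add' v w := by
    have : toComplexVec (v.ofLp + w.ofLp) = toComplexVec v.ofLp + toComplexVec w.ofLp := by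
      ext i; simp [toComplexVec, Complex.ext_iff]
    ext i
    rcases i with i | i <;> simp [this, Matrix.mulVec_add]
  map_smul' c v := by
    have : toComplexVec (c • v.ofLp) = c • toComplexVec v.ofLp := by
      ext i; simp [toComplexVec, Complex.ext_iff]
    ext i
    rcases i with i | i <;> simp [this, Matrix.mulVec_smul]
  norm_map' v := by
    have h := sum_norm_sq_unitary_mulVec U (toComplexVec v.ofLp)
    simp only [norm_sq_toComplexVec] at h
    simp only [← Complex.normSq_eq_norm_sq, Complex.normSq_apply, Finset.sum_add_distrib] at h
    rw [EuclideanSpace.norm_eq, EuclideanSpace.norm_eq]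
    congr 1
    simp only [LinearMap.coe_mk, AddHom.coe_mk, Fintype.sum_sum_type, Sum.elim_inl, Sum.elim_inr,
      Real.norm_eq_abs, sq_abs]
    simpa only [pow_two] using h

lemma toComplexVec_realAction (U : Matrix.unitaryGroup ι ℂ) (v : EuclideanSpace ℝ (ι ⊕ ι)) :
    toComplexVec (realAction U v).ofLp = (U : Matrix ι ι ℂ) *ᵥ toComplexVec v.ofLp := by
  ext i; simp [toComplexVec, realAction]

/-- On real and imaginary parts a unitary acts as a linear isometry, and the standard Gaussian
measure is invariant under those. No regularity of `F` is needed, because every change of variables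
is along a measurable embedding. -/
lemma integral_gaussianParts_unitary (U : Matrix.unitaryGroup ι ℂ) (F : (ι → ℂ) → ℝ) :
    ∫ x, F ((U : Matrix ι ι ℂ) *ᵥ toComplexVec x) ∂gaussianParts ι =
      ∫ x, F (toComplexVec x) ∂gaussianParts ι := by
  let e := (realAction U).toLinearIsometryEquiv rfl
  have key : ∀ G : (ι → ℂ) → ℝ, ∫ x, G (toComplexVec x) ∂gaussianParts ι =
      ∫ v, G (toComplexVec v.ofLp) ∂stdGaussian (EuclideanSpace ℝ (ι ⊕ ι)) := by
    intro G
    rw [← map_pi_eq_stdGaussian,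
      show (WithLp.toLp 2 : (ι ⊕ ι → ℝ) → _) = MeasurableEquiv.toLp 2 (ι ⊕ ι → ℝ) from rfl,
      (MeasurableEquiv.toLp 2 (ι ⊕ ι → ℝ)).measurableEmbedding.integral_map]
    rfl
  have hm : MeasurePreserving e (stdGaussian (EuclideanSpace ℝ (ι ⊕ ι)))
      (stdGaussian (EuclideanSpace ℝ (ι ⊕ ι))) :=
    ⟨e.continuous.measurable, stdGaussian_map e⟩
  rw [key (fun z => F ((U : Matrix ι ι ℂ) *ᵥ z)), key F,
    ← hm.integral_comp e.toHomeomorph.measurableEmbedding (fun v => F (toComplexVec v.ofLp))]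
  simp only [← toComplexVec_realAction]
  rfl

end Gaussian

/-! ### Laplace transforms of quadratic forms in random unit vectors. -/

section Laplace

variable {ι : Type} [Fintype ι] [DecidableEq ι]

/-- The quadratic form of a real diagonal matrix. -/
def diagForm {ι : Type} [Fintype ι] (D : ι → ℝ) (w : ι → ℂ) : ℝ := ∑ i, D i * ‖w i‖ ^ 2

lemma diagForm_smul {ι : Type} [Fintype ι] (D : ι → ℝ) (c : ℂ) (w : ι → ℂ) :
    diagForm D (c • w) = ‖c‖ ^ 2 * diagForm D w := by
  simp only [diagForm, Pi.smul_apply, smul_eq_mul, norm_mul, mul_pow, Finset.mul_sum]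
  exact Finset.sum_congr rfl fun i _ => by ring

lemma continuous_diagForm {ι : Type} [Fintype ι] (D : ι → ℝ) : Continuous (diagForm D) := by
  unfold diagForm; fun_prop

lemma abs_diagForm_le {ι : Type} [Fintype ι] {D : ι → ℝ} {C : ℝ} (hD : ∀ i, |D i| ≤ C)
    (w : ι → ℂ) : |diagForm D w| ≤ C * ∑ i, ‖w i‖ ^ 2 := by
  rw [Finset.mul_sum]
  refine (Finset.abs_sum_le_sum_abs _ _).trans (Finset.sum_le_sum fun i _ => ?_)
  rw [abs_mul, abs_of_nonneg (sq_nonneg ‖w i‖)]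
  exact mul_le_mul_of_nonneg_right (hD i) (sq_nonneg _)

lemma continuous_unitary_mulVec :
    Continuous (fun p : Matrix.unitaryGroup ι ℂ × (ι → ℂ) => (p.1 : Matrix ι ι ℂ) *ᵥ p.2) :=
  (continuous_unitary_coe.comp continuous_fst).matrix_mulVec continuous_snd

/-- By homogeneity the form at `U z` depends on the length of `z` only through a scalar factor. This
separates radius from direction in the comparison with Gaussian vectors. -/
lemma integral_haar_diagForm (i₀ : ι) (z : ι → ℂ) (D : ι → ℝ) (F : ℝ → ℝ) :
    ∫ U : Matrix.unitaryGroup ι ℂ, F (diagForm D ((U : Matrix ι ι ℂ) *ᵥ z)) ∂haarUnitary ι =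
      ∫ U : Matrix.unitaryGroup ι ℂ, F ((∑ i, ‖z i‖ ^ 2) *
        diagForm D ((U : Matrix ι ι ℂ) *ᵥ Pi.single i₀ 1)) ∂haarUnitary ι := by
  set r := ∑ i, ‖z i‖ ^ 2 with hr
  have hr0 : 0 ≤ r := Finset.sum_nonneg fun i _ => sq_nonneg _
  rcases hr0.eq_or_lt with h0 | hpos
  · have hz : z = 0 := by
      ext i
      have := (Finset.sum_eq_zero_iff_of_nonneg (fun i _ => sq_nonneg ‖z i‖)).1
        (hr.symm.trans h0.symm) i (Finset.mem_univ i)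
      simpa using this
    simp [hz, ← h0, diagForm]
  · have hc : ‖((√r : ℝ) : ℂ)‖ ^ 2 = r := by
      rw [Complex.norm_real, Real.norm_eq_abs, sq_abs, Real.sq_sqrt hr0]
    have hne : ((√r : ℝ) : ℂ) ≠ 0 := by
      exact_mod_cast (Real.sqrt_pos.2 hpos).ne'
    set ψ : ι → ℂ := ((√r : ℝ) : ℂ)⁻¹ • z with hψ
    have hz : z = ((√r : ℝ) : ℂ) • ψ := by rw [hψ, smul_inv_smul₀ hne]
    have hψ1 : ∑ i, ‖ψ i‖ ^ 2 = 1 := by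
      simp only [hψ, Pi.smul_apply, smul_eq_mul, norm_mul, norm_inv, mul_pow, inv_pow, hc,
        ← Finset.mul_sum, ← hr]
      exact inv_mul_cancel₀ hpos.ne'
    rw [← integral_haar_mulVec_eq i₀ ψ hψ1 (fun w => F (r * diagForm D w))]
    congr 1
    ext U
    rw [hz, Matrix.mulVec_smul, diagForm_smul, hc]

lemma one_div_one_sub_le_exp {s : ℝ} (hs : |s| ≤ 1 / 2) : 1 / (1 - s) ≤ Real.exp (s + s ^ 2) := by
  obtain ⟨h1, h2⟩ := abs_le.1 hs
  rw [div_le_iff₀ (by linarith)]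
  rcases le_total s 0 with h | h
  -- For `s ≤ 0` the linear lower bound on the exponential suffices; for `s ≥ 0` the quadratic term
  -- is needed, and the surplus is exactly the product `h6`.
  · have h3 := Real.add_one_le_exp (s + s ^ 2)
    have h4 : (s + s ^ 2 + 1) * (1 - s) ≤ Real.exp (s + s ^ 2) * (1 - s) :=
      mul_le_mul_of_nonneg_right h3 (by linarith)
    have h5 : s ^ 3 ≤ 0 := by
      have : 0 ≤ (-s) * s ^ 2 := mul_nonneg (by linarith) (sq_nonneg s)
      nlinarith
    nlinarith
  · have h3 := Real.quadratic_le_exp_of_nonneg (show 0 ≤ s + s ^ 2 by positivity)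
    have h4 : (1 + (s + s ^ 2) + (s + s ^ 2) ^ 2 / 2) * (1 - s) ≤
      Real.exp (s + s ^ 2) * (1 - s) := mul_le_mul_of_nonneg_right h3 (by linarith)
    have h6 : 0 ≤ s ^ 2 / 2 * (1 - s - s ^ 2 - s ^ 3) := by
      apply mul_nonneg (by positivity)
      nlinarith [sq_nonneg s, mul_nonneg h h]
    nlinarith

/-- The integrand factors over the real coordinates. Real and imaginary parts contribute the same
square root, which removes the root from the product. -/
lemma integral_exp_diagForm_gaussian {ι : Type} [Fintype ι] (D : ι → ℝ) (hD : ∀ i, D i < 1 / 2) :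
    ∫ x, Real.exp (diagForm D (toComplexVec x)) ∂gaussianParts ι = ∏ i, (1 / (1 - 2 * D i)) := by
  have h : ∀ x : ι ⊕ ι → ℝ, Real.exp (diagForm D (toComplexVec x)) =
      ∏ j : ι ⊕ ι, Real.exp (Sum.elim D D j * x j ^ 2) := by
    intro x
    simp only [diagForm, norm_sq_toComplexVec]
    rw [← Real.exp_sum, Fintype.sum_sum_type]
    simp only [Sum.elim_inl, Sum.elim_inr, mul_add, Finset.sum_add_distrib]
  simp only [h]
  rw [gaussianParts, integral_fintype_prod_eq_prod
    (f := fun j x => Real.exp (Sum.elim D D j * x ^ 2)), Fintype.prod_sum_type,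
    ← Finset.prod_mul_distrib]
  refine Finset.prod_congr rfl fun i _ => ?_
  simp only [Sum.elim_inl, Sum.elim_inr]
  rw [integral_exp_mul_sq_gaussianReal (hD i), Real.mul_self_sqrt]
  have := hD i
  exact div_nonneg zero_le_one (by linarith)

lemma integrable_exp_diagForm_gaussian {ι : Type} [Fintype ι] (D : ι → ℝ) (hD : ∀ i, D i < 1 / 2) :
    Integrable (fun x => Real.exp (diagForm D (toComplexVec x))) (gaussianParts ι) := by
  have h : ∀ x : ι ⊕ ι → ℝ, Real.exp (diagForm D (toComplexVec x)) =
      ∏ j : ι ⊕ ι, Real.exp (Sum.elim D D j * x j ^ 2) := by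
    intro x
    simp only [diagForm, norm_sq_toComplexVec]
    rw [← Real.exp_sum, Fintype.sum_sum_type]
    simp only [Sum.elim_inl, Sum.elim_inr, mul_add, Finset.sum_add_distrib]
  simp only [h]
  refine Integrable.fintype_prod (f := fun j x => Real.exp (Sum.elim D D j * x ^ 2)) fun j => ?_
  apply integrable_exp_mul_sq_gaussianReal
  rcases j with j | j <;> exact hD j

lemma integral_norm_sq_gaussian {ι : Type} [Fintype ι] :
    Integrable (fun x => ∑ i, ‖toComplexVec x i‖ ^ 2) (gaussianParts ι) ∧
    ∫ x, ∑ i, ‖toComplexVec x i‖ ^ 2 ∂gaussianParts ι = 2 * Fintype.card ι := by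
  have hint : ∀ j : ι ⊕ ι, Integrable (fun x : ι ⊕ ι → ℝ => x j ^ 2) (gaussianParts ι) := by
    intro j
    have h1 : Integrable (fun x : ℝ => x ^ 2) (gaussianReal 0 1) := by
      -- A non-integrable function would have integral zero, while the second moment is 1.
      by_contra h
      have := integral_undef h
      rw [integral_sq_gaussianReal] at this
      exact one_ne_zero this
    exact integrable_comp_eval (i := j) (μ := fun _ : ι ⊕ ι => gaussianReal 0 1) h1
  have hval : ∀ j : ι ⊕ ι, ∫ x, x j ^ 2 ∂gaussianParts ι = 1 := by
    intro j
    rw [← integral_sq_gaussianReal]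
    exact integral_comp_eval (i := j) (μ := fun _ : ι ⊕ ι => gaussianReal 0 1)
      (f := fun x => x ^ 2) (by fun_prop)
  simp only [norm_sq_toComplexVec]
  constructor
  · exact integrable_finsetSum _ fun i _ => (hint _).add (hint _)
  · rw [integral_finsetSum (s := Finset.univ)
      (f := fun i (x : ι ⊕ ι → ℝ) => x (.inl i) ^ 2 + x (.inr i) ^ 2)
      fun i _ => (hint _).add (hint _)]
    simp only [integral_add (hint _) (hint _), hval]
    simp; ring

lemma integrable_haar_of_continuous {f : Matrix.unitaryGroup ι ℂ → ℝ} (hf : Continuous f) :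
    Integrable f (haarUnitary ι) :=
  hf.integrable_of_hasCompactSupport (HasCompactSupport.of_compactSpace f)

/-- The Laplace transform of a quadratic form in a uniformly random unit vector is dominated by that
of the same form in a Gaussian vector. -/
lemma integral_haar_exp_le_prod (i₀ : ι) (D : ι → ℝ) (hD : ∀ i, |D i| ≤ 1 / 4) :
    ∫ U : Matrix.unitaryGroup ι ℂ, Real.exp (2 * Fintype.card ι *
        diagForm D ((U : Matrix ι ι ℂ) *ᵥ Pi.single i₀ 1)) ∂haarUnitary ι ≤
      ∏ i, (1 / (1 - 2 * D i)) := by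
  set q : Matrix.unitaryGroup ι ℂ → ℝ :=
    fun U => diagForm D ((U : Matrix ι ι ℂ) *ᵥ Pi.single i₀ 1) with hq
  have hqc : Continuous q := (continuous_diagForm D).comp
    (continuous_unitary_mulVec.comp (continuous_id.prodMk continuous_const))
  set d : ℝ := 2 * Fintype.card ι with hd
  set M := ∫ U, Real.exp (d * q U) ∂haarUnitary ι with hM
  set A := ∫ U, q U * Real.exp (d * q U) ∂haarUnitary ι with hA
  set r : (ι ⊕ ι → ℝ) → ℝ := fun x => ∑ i, ‖toComplexVec x i‖ ^ 2 with hr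
  obtain ⟨hrint, hrval⟩ := integral_norm_sq_gaussian (ι := ι)
  have hint : Integrable (fun p : (ι ⊕ ι → ℝ) × Matrix.unitaryGroup ι ℂ =>
      Real.exp (diagForm D ((p.2 : Matrix ι ι ℂ) *ᵥ toComplexVec p.1)))
      ((gaussianParts ι).prod (haarUnitary ι)) := by
    -- Since `U` preserves the norm, `exp (‖x‖² / 4)` dominates uniformly in `U`; it is integrable
    -- because `1 / 4 < 1 / 2`.
    have h1 : Integrable (fun p : (ι ⊕ ι → ℝ) × Matrix.unitaryGroup ι ℂ =>
        Real.exp (diagForm (fun _ => 1 / 4) (toComplexVec p.1)))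
        ((gaussianParts ι).prod (haarUnitary ι)) :=
      (integrable_exp_diagForm_gaussian (fun _ => 1 / 4) (fun _ => by norm_num)).comp_fst _
    refine h1.mono' ?_ (Filter.Eventually.of_forall fun p => ?_)
    · apply Continuous.aestronglyMeasurable
      exact Real.continuous_exp.comp ((continuous_diagForm D).comp
        (continuous_unitary_mulVec.comp
          (continuous_snd.prodMk (continuous_toComplexVec.comp continuous_fst))))
    · rw [Real.norm_eq_abs, Real.abs_exp, Real.exp_le_exp]
      refine (le_abs_self _).trans ((abs_diagForm_le hD _).trans ?_)
      rw [sum_norm_sq_unitary_mulVec, diagForm, Finset.mul_sum]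
  have hswap := integral_integral_swap (f := fun (x : ι ⊕ ι → ℝ) (U : Matrix.unitaryGroup ι ℂ) =>
      Real.exp (diagForm D ((U : Matrix ι ι ℂ) *ᵥ toComplexVec x))) hint
  have hinner : ∀ x, ∫ U : Matrix.unitaryGroup ι ℂ,
      Real.exp (diagForm D ((U : Matrix ι ι ℂ) *ᵥ toComplexVec x)) ∂haarUnitary ι =
      ∫ U, Real.exp (r x * q U) ∂haarUnitary ι :=
    fun x => integral_haar_diagForm i₀ (toComplexVec x) D Real.exp
  have hright : ∀ U : Matrix.unitaryGroup ι ℂ,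
      ∫ x, Real.exp (diagForm D ((U : Matrix ι ι ℂ) *ᵥ toComplexVec x)) ∂gaussianParts ι =
      ∏ i, (1 / (1 - 2 * D i)) := by
    intro U
    rw [integral_gaussianParts_unitary U (fun w => Real.exp (diagForm D w))]
    exact integral_exp_diagForm_gaussian D fun i => by
      have := (abs_le.1 (hD i)).2; linarith
  have hΦ := hint.integral_prod_left
  simp only [hright, hinner, integral_const, probReal_univ, one_smul] at hswap hΦ
  rw [← hswap]
  -- The right side is convex in `r`; the left side is its tangent at `r = d`. As `d` is the mean of
  -- `r`, integrating the tangent line gives Jensen's inequality.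
  have hlow : ∀ x, M + A * (r x - d) ≤ ∫ U, Real.exp (r x * q U) ∂haarUnitary ι := by
    intro x
    have e1 : M + A * (r x - d) =
        ∫ U, (Real.exp (d * q U) + q U * Real.exp (d * q U) * (r x - d)) ∂haarUnitary ι := by
      rw [integral_add, integral_mul_const]
      · exact integrable_haar_of_continuous (by fun_prop)
      · exact integrable_haar_of_continuous (by fun_prop)
    rw [e1]
    apply integral_mono
    · exact integrable_haar_of_continuous (by fun_prop)
    · exact integrable_haar_of_continuous (by fun_prop)
    · intro U
      have h := Real.add_one_le_exp ((r x - d) * q U)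
      have h2 := mul_le_mul_of_nonneg_left h (Real.exp_pos (d * q U)).le
      rw [← Real.exp_add] at h2
      have h3 : d * q U + (r x - d) * q U = r x * q U := by ring
      rw [h3] at h2
      simp only
      linarith
  have hmean : ∫ x, (M + A * (r x - d)) ∂gaussianParts ι = M := by
    have h1 : Integrable (fun x => A * (r x - d)) (gaussianParts ι) :=
      (hrint.sub (integrable_const _)).const_mul A
    rw [integral_add (integrable_const _) h1, integral_const_mul,
      integral_sub hrint (integrable_const _), hrval]
    simp [hd]
  calc M = ∫ x, (M + A * (r x - d)) ∂gaussianParts ι := hmean.symm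
    _ ≤ _ := integral_mono ((integrable_const _).add
        ((hrint.sub (integrable_const _)).const_mul A)) hΦ hlow

/-- Subgaussian Laplace transform of a centred quadratic form in a random unit vector. -/
lemma integral_haar_exp_diagForm_le (D : ι → ℝ) (hD0 : ∑ i, D i = 0) (hD : ∀ i, |D i| ≤ 2)
    (ψ : ι → ℂ) (hψ : ∑ i, ‖ψ i‖ ^ 2 = 1) {μ : ℝ} (hμ0 : 0 ≤ μ) (hμ : μ ≤ Fintype.card ι / 4) :
    ∫ U : Matrix.unitaryGroup ι ℂ, Real.exp (μ * diagForm D ((U : Matrix ι ι ℂ) *ᵥ ψ))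
      ∂haarUnitary ι ≤ Real.exp (4 * μ ^ 2 / Fintype.card ι) := by
  have hne : Nonempty ι := by
    by_contra h
    rw [not_nonempty_iff] at h
    simp at hψ
  obtain ⟨i₀⟩ := hne
  have hd : (0 : ℝ) < Fintype.card ι := by
    exact_mod_cast Fintype.card_pos_iff.2 ⟨i₀⟩
  set d : ℝ := (Fintype.card ι : ℝ) with hdd
  -- The Gaussian comparison is applied to `a D`, since its factor `2 d` then restores `μ D`; `μ ≤ d
  -- / 4` and `|D i| ≤ 2` keep `a D` within `1 / 4`.
  set a : ℝ := μ / (2 * d) with ha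
  have ha0 : 0 ≤ a := by positivity
  have ha8 : a ≤ 1 / 8 := by rw [ha, div_le_iff₀ (by positivity)]; linarith
  have hμa : 2 * d * a = μ := by rw [ha]; field_simp
  have hb : ∀ i, |a * D i| ≤ 1 / 4 := fun i => by
    rw [abs_mul, abs_of_nonneg ha0]
    calc a * |D i| ≤ 1 / 8 * 2 := by gcongr; exact hD i
      _ = 1 / 4 := by norm_num
  have h := integral_haar_exp_le_prod i₀ (fun i => a * D i) hb
  rw [integral_haar_mulVec_eq i₀ ψ hψ (fun w => Real.exp (μ * diagForm D w))]
  have hform : ∀ w : ι → ℂ, 2 * d * diagForm (fun i => a * D i) w = μ * diagForm D w := by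
    intro w
    rw [← hμa]
    simp only [diagForm, mul_assoc, Finset.mul_sum]
  simp only [← hdd, hform] at h
  refine h.trans ?_
  calc ∏ i, (1 / (1 - 2 * (a * D i)))
      ≤ ∏ i, Real.exp (2 * (a * D i) + (2 * (a * D i)) ^ 2) := by
        refine Finset.prod_le_prod (fun i _ => ?_) fun i _ => ?_
        · have := (abs_le.1 (hb i)).2
          exact div_nonneg zero_le_one (by linarith)
        · apply one_div_one_sub_le_exp
          rw [abs_mul, abs_of_pos (by norm_num : (0 : ℝ) < 2)]
          linarith [hb i]
    _ = Real.exp (∑ i, (2 * a * D i + 4 * a ^ 2 * D i ^ 2)) := by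
        rw [← Real.exp_sum]
        congr 1
        exact Finset.sum_congr rfl fun i _ => by ring
    _ ≤ Real.exp (4 * μ ^ 2 / d) := by
        -- The trace condition kills the linear term, so the bound is purely quadratic in `μ`.
        rw [Real.exp_le_exp, Finset.sum_add_distrib, ← Finset.mul_sum, hD0, mul_zero, zero_add,
          ← Finset.mul_sum]
        have h4 : ∑ i, D i ^ 2 ≤ d * 4 := by
          calc ∑ i, D i ^ 2 ≤ ∑ _i : ι, (4 : ℝ) := Finset.sum_le_sum fun i _ => by
                rw [← sq_abs]; nlinarith [hD i, abs_nonneg (D i)]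
            _ = d * 4 := by simp [hdd]
        calc 4 * a ^ 2 * ∑ i, D i ^ 2 ≤ 4 * a ^ 2 * (d * 4) := by gcongr
          _ = 4 * μ ^ 2 / d := by rw [← hμa]; field_simp; ring

/-- Chernoff bound for the average of a centred quadratic form over independent random unit
vectors. -/
lemma measure_avg_diagForm_ge_le (t : ℕ) (D : ι → ℝ) (hD0 : ∑ i, D i = 0) (hD : ∀ i, |D i| ≤ 2)
    (ψ : ι → ℂ) (hψ : ∑ i, ‖ψ i‖ ^ 2 = 1) {η : ℝ} (hη0 : 0 ≤ η) (hη : η ≤ 2) :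
    (Measure.pi fun _ : Fin t => haarUnitary ι).real
      {U | t * η ≤ ∑ k, diagForm D ((U k : Matrix ι ι ℂ) *ᵥ ψ)} ≤
      Real.exp (-(t * Fintype.card ι * η ^ 2 / 16)) := by
  set d : ℝ := (Fintype.card ι : ℝ) with hdd
  have hd : 0 < d := by
    rw [hdd, Nat.cast_pos, Fintype.card_pos_iff]
    by_contra h
    rw [not_nonempty_iff] at h
    simp at hψ
  -- Minimizer of `-t η μ + 4 t μ² / d`; `η ≤ 2` makes it admissible for the Laplace bound.
  set μ : ℝ := d * η / 8 with hμ
  have hμ0 : 0 ≤ μ := by positivity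
  have hc : Continuous fun U : Matrix.unitaryGroup ι ℂ =>
      diagForm D ((U : Matrix ι ι ℂ) *ᵥ ψ) :=
    (continuous_diagForm D).comp
      (continuous_unitary_mulVec.comp (continuous_id.prodMk continuous_const))
  have hexp : ∀ U : Fin t → Matrix.unitaryGroup ι ℂ,
      Real.exp (μ * ∑ k, diagForm D ((U k : Matrix ι ι ℂ) *ᵥ ψ)) =
      ∏ k, Real.exp (μ * diagForm D ((U k : Matrix ι ι ℂ) *ᵥ ψ)) := by
    intro U; rw [Finset.mul_sum, Real.exp_sum]
  have hint : Integrable (fun U : Fin t → Matrix.unitaryGroup ι ℂ =>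
      Real.exp (μ * ∑ k, diagForm D ((U k : Matrix ι ι ℂ) *ᵥ ψ)))
      (Measure.pi fun _ : Fin t => haarUnitary ι) := by
    simp only [hexp]
    exact Integrable.fintype_prod (f := fun _ (U : Matrix.unitaryGroup ι ℂ) =>
      Real.exp (μ * diagForm D ((U : Matrix ι ι ℂ) *ᵥ ψ)))
      fun _ => integrable_haar_of_continuous (by fun_prop)
  refine (measure_ge_le_exp_mul_mgf (t * η) hμ0 hint).trans ?_
  have hmgf : mgf (fun U : Fin t → Matrix.unitaryGroup ι ℂ =>
      ∑ k, diagForm D ((U k : Matrix ι ι ℂ) *ᵥ ψ)) (Measure.pi fun _ : Fin t => haarUnitary ι) μ ≤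
      Real.exp (4 * μ ^ 2 / d) ^ t := by
    rw [mgf]
    simp only [hexp]
    rw [integral_fintype_prod_eq_pow (fun U : Matrix.unitaryGroup ι ℂ =>
      Real.exp (μ * diagForm D ((U : Matrix ι ι ℂ) *ᵥ ψ))), Fintype.card_fin]
    refine pow_le_pow_left₀ (integral_nonneg fun _ => (Real.exp_pos _).le) ?_ t
    refine integral_haar_exp_diagForm_le D hD0 hD ψ hψ hμ0 ?_
    rw [← hdd, hμ]; nlinarith
  refine (mul_le_mul_of_nonneg_left hmgf (Real.exp_pos _).le).trans ?_
  rw [← Real.exp_nat_mul, ← Real.exp_add, Real.exp_le_exp, hμ]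
  apply le_of_eq
  field_simp
  ring

end Laplace

/-! ### Nets and operator bounds -/

section Net

/-- A `1/2`-net of the complex unit sphere of size exponential in the dimension. -/
lemma exists_sphere_net (ι : Type) [Fintype ι] :
    ∃ S : Finset (ι → ℂ), S.card ≤ 5 ^ (2 * Fintype.card ι) ∧ (∀ φ ∈ S, ∑ i, ‖φ i‖ ^ 2 = 1) ∧
      ∀ ψ : ι → ℂ, ∑ i, ‖ψ i‖ ^ 2 = 1 → ∃ φ ∈ S, ∑ i, ‖φ i - ψ i‖ ^ 2 ≤ 1 / 4 := by
  classical
  let E := EuclideanSpace ℂ ι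
  -- The net is a 1-separated subset, of maximal size, of the sphere of radius 2, later scaled by `1
  -- / 2`. This scale is the one in the packing bound `Besicovitch.card_le_of_separated`, applied in
  -- real dimension `2 * card ι`.
  let A : Set ℕ := {m | ∃ T : Finset E, (∀ c ∈ T, ‖c‖ = 2) ∧
    (∀ c ∈ T, ∀ d ∈ T, c ≠ d → 1 ≤ ‖c - d‖) ∧ T.card = m}
  have hA0 : A.Nonempty := ⟨0, ∅, by simp⟩
  have hfin : Module.finrank ℝ E = 2 * Fintype.card ι := by
    rw [finrank_real_of_complex, finrank_euclideanSpace]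
  have hbound : ∀ m ∈ A, m ≤ 5 ^ (2 * Fintype.card ι) := by
    rintro m ⟨T, h1, h2, rfl⟩
    rw [← hfin]
    exact Besicovitch.card_le_of_separated T (fun c hc => (h1 c hc).le) h2
  have hAb : BddAbove A := ⟨_, hbound⟩
  obtain ⟨T, hT1, hT2, hT3⟩ := Nat.sSup_mem hA0 hAb
  have hsq : ∀ v : E, ‖v‖ ^ 2 = ∑ i, ‖v i‖ ^ 2 := fun v => EuclideanSpace.norm_sq_eq v
  refine ⟨T.image fun c i => (1 / 2 : ℂ) * c i, ?_, ?_, ?_⟩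
  · exact Finset.card_image_le.trans (hT3 ▸ hbound _ (Nat.sSup_mem hA0 hAb))
  · intro φ hφ
    obtain ⟨c, hc, rfl⟩ := Finset.mem_image.1 hφ
    have := hsq c
    rw [hT1 c hc] at this
    simp only [norm_mul, mul_pow, ← Finset.mul_sum, ← this]
    norm_num
  · intro ψ hψ
    set v : E := WithLp.toLp 2 fun i => 2 * ψ i with hv
    have hvn : ‖v‖ = 2 := by
      have : ‖v‖ ^ 2 = 2 ^ 2 := by
        rw [hsq]
        simp only [hv, norm_mul, mul_pow, ← Finset.mul_sum, hψ]
        norm_num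
      exact (sq_eq_sq₀ (norm_nonneg _) (by norm_num)).1 this
    have hex : ∃ c ∈ T, ‖c - v‖ ≤ 1 := by
      by_contra! hcon
      have hvT : v ∉ T := fun h => by
        have := hcon v h
        simp at this
        linarith
      have hmem : T.card + 1 ∈ A := by
        refine ⟨insert v T, ?_, ?_, Finset.card_insert_of_notMem hvT⟩
        · intro c hc
          rcases Finset.mem_insert.1 hc with rfl | hc
          · exact hvn
          · exact hT1 c hc
        · intro c hc d hd hcd
          rcases Finset.mem_insert.1 hc with rfl | hc <;> rcases Finset.mem_insert.1 hd with rfl | hd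
          · exact absurd rfl hcd
          · rw [norm_sub_rev]; exact (hcon d hd).le
          · exact (hcon c hc).le
          · exact hT2 c hc d hd hcd
      have := le_csSup hAb hmem
      omega
    obtain ⟨c, hc, hcv⟩ := hex
    refine ⟨_, Finset.mem_image_of_mem _ hc, ?_⟩
    have h1 : ∑ i, ‖(1 / 2 : ℂ) * c i - ψ i‖ ^ 2 = 1 / 4 * ‖c - v‖ ^ 2 := by
      rw [hsq, Finset.mul_sum]
      refine Finset.sum_congr rfl fun i _ => ?_
      have : (1 / 2 : ℂ) * c i - ψ i = 1 / 2 * (c - v) i := by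
        rw [hv, PiLp.sub_apply]; ring
      rw [this, norm_mul, mul_pow]
      norm_num
    rw [h1]
    nlinarith [norm_nonneg (c - v)]

variable {ι : Type} [Fintype ι] [DecidableEq ι]

lemma IsHermitian_eq_conj_diagonal {H : Matrix ι ι ℂ} (hH : H.IsHermitian) :
    H = (hH.eigenvectorUnitary : Matrix ι ι ℂ) *
      Matrix.diagonal (fun i => (hH.eigenvalues i : ℂ)) *
      (hH.eigenvectorUnitary : Matrix ι ι ℂ)ᴴ := by
  conv_lhs => rw [hH.spectral_theorem]
  rfl

lemma re_dotProduct_conj_diagonal (V : Matrix ι ι ℂ) (D : ι → ℝ) (φ : ι → ℂ) :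
    (star φ ⬝ᵥ ((Vᴴ * Matrix.diagonal (fun i => (D i : ℂ)) * V) *ᵥ φ)).re =
      diagForm D (V *ᵥ φ) := by
  rw [← Matrix.mulVec_mulVec, ← Matrix.mulVec_mulVec, Matrix.dotProduct_mulVec,
    ← Matrix.star_mulVec]
  simp only [dotProduct, Matrix.mulVec_diagonal, Pi.star_apply, Complex.re_sum, diagForm]
  refine Finset.sum_congr rfl fun i _ => ?_
  rw [← Complex.normSq_eq_norm_sq, Complex.normSq_apply]
  simp
  ring

lemma posSemidef_conj_diagonal (V : Matrix ι ι ℂ) {D : ι → ℝ} (hD : ∀ i, 0 ≤ D i) :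
    (Vᴴ * Matrix.diagonal (fun i => (D i : ℂ)) * V).PosSemidef := by
  refine Matrix.PosSemidef.conjTranspose_mul_mul_same ?_ V
  exact Matrix.PosSemidef.diagonal fun i => by simpa using hD i

/-- Control of a quadratic form on a net controls the operator. -/
lemma posSemidef_of_net {S : Finset (ι → ℂ)} (hS1 : ∀ φ ∈ S, ∑ i, ‖φ i‖ ^ 2 = 1)
    (hS : ∀ ψ : ι → ℂ, ∑ i, ‖ψ i‖ ^ 2 = 1 → ∃ φ ∈ S, ∑ i, ‖φ i - ψ i‖ ^ 2 ≤ 1 / 4)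
    {H : Matrix ι ι ℂ} (hH : H.IsHermitian) {η : ℝ}
    (hη : ∀ φ ∈ S, |(star φ ⬝ᵥ (H *ᵥ φ)).re| ≤ η) :
    (((2 * η : ℝ) : ℂ) • (1 : Matrix ι ι ℂ) - H).PosSemidef := by
  set V := hH.eigenvectorUnitary with hV
  set lam := hH.eigenvalues with hlam
  have hspec := IsHermitian_eq_conj_diagonal hH
  rw [← hV, ← hlam] at hspec
  have hVV : (V : Matrix ι ι ℂ) * (V : Matrix ι ι ℂ)ᴴ = 1 := by
    rw [← Matrix.star_eq_conjTranspose]; exact Unitary.coe_mul_star_self V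
  have hVV' : (V : Matrix ι ι ℂ)ᴴ * (V : Matrix ι ι ℂ) = 1 := by
    rw [← Matrix.star_eq_conjTranspose]; exact Unitary.coe_star_mul_self V
  have hbound : ∀ j, lam j ≤ 2 * η := by
    intro j
    -- The net is tested near the eigenvector of an eigenvalue of largest modulus `K`. A net point
    -- within `1 / 2` of it has weight `x ≥ 3 / 4` on that eigenvector, so `K x ≤ η + K (1 - x)`
    -- forces `K ≤ 2 η`.
    obtain ⟨i₀, hi₀⟩ : ∃ i₀, ∀ i, |lam i| ≤ |lam i₀| := by
      obtain ⟨i₀, -, h⟩ := Finset.exists_max_image Finset.univ (fun i => |lam i|) ⟨j, Finset.mem_univ j⟩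
      exact ⟨i₀, fun i => h i (Finset.mem_univ i)⟩
    set K := |lam i₀| with hK
    have hK0 : 0 ≤ K := abs_nonneg _
    set ψ : ι → ℂ := (V : Matrix ι ι ℂ) *ᵥ Pi.single i₀ 1 with hψ
    have hψ1 : ∑ i, ‖ψ i‖ ^ 2 = 1 := by
      rw [hψ, sum_norm_sq_unitary_mulVec,
        Finset.sum_eq_single i₀ (fun i _ hi => by simp [hi]) (by simp)]
      simp
    obtain ⟨φ, hφS, hφ⟩ := hS ψ hψ1
    set w : ι → ℂ := (V : Matrix ι ι ℂ)ᴴ *ᵥ φ with hw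
    have hunit : ∀ z : ι → ℂ, ∑ i, ‖((V : Matrix ι ι ℂ)ᴴ *ᵥ z) i‖ ^ 2 = ∑ i, ‖z i‖ ^ 2 :=
      fun z => sum_norm_sq_unitary_mulVec (star V) z
    have hw1 : ∑ i, ‖w i‖ ^ 2 = 1 := (hunit φ).trans (hS1 φ hφS)
    have hwd : ∑ i, ‖w i - (Pi.single i₀ 1 : ι → ℂ) i‖ ^ 2 ≤ 1 / 4 := by
      refine le_trans (le_of_eq ?_) hφ
      have : w - Pi.single i₀ 1 = (V : Matrix ι ι ℂ)ᴴ *ᵥ (φ - ψ) := by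
        rw [Matrix.mulVec_sub, hψ, Matrix.mulVec_mulVec, hVV', Matrix.one_mulVec]
      have h2 := hunit (φ - ψ)
      rw [← this] at h2
      simpa using h2
    have hform : (star φ ⬝ᵥ (H *ᵥ φ)).re = diagForm lam w := by
      have := re_dotProduct_conj_diagonal ((V : Matrix ι ι ℂ)ᴴ) lam φ
      rw [Matrix.conjTranspose_conjTranspose, ← hspec] at this
      exact this
    have h1 := hη φ hφS
    rw [hform] at h1
    set x := ‖w i₀‖ ^ 2 with hx
    have hsplit : ∑ i ∈ Finset.univ.erase i₀, ‖w i‖ ^ 2 = 1 - x := by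
      rw [← hw1, ← Finset.add_sum_erase _ _ (Finset.mem_univ i₀)]; ring
    have hsplit2 : ‖w i₀ - 1‖ ^ 2 + (1 - x) ≤ 1 / 4 := by
      rw [← Finset.add_sum_erase _ _ (Finset.mem_univ i₀)] at hwd
      have : ∑ i ∈ Finset.univ.erase i₀, ‖w i - (Pi.single i₀ 1 : ι → ℂ) i‖ ^ 2 = 1 - x := by
        rw [← hsplit]
        refine Finset.sum_congr rfl fun i hi => ?_
        rw [Pi.single_eq_of_ne (Finset.ne_of_mem_erase hi), sub_zero]
      rw [this] at hwd
      simpa using hwd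
    have hre : 7 / 8 ≤ (w i₀).re := by
      rw [hx, ← Complex.normSq_eq_norm_sq, ← Complex.normSq_eq_norm_sq, Complex.normSq_apply,
        Complex.normSq_apply] at hsplit2
      simp at hsplit2
      nlinarith
    have hx34 : 3 / 4 ≤ x := by
      rw [hx, ← Complex.normSq_eq_norm_sq, Complex.normSq_apply]
      nlinarith [mul_self_nonneg (w i₀).im]
    have hdf : diagForm lam w = lam i₀ * x + ∑ i ∈ Finset.univ.erase i₀, lam i * ‖w i‖ ^ 2 := by
      rw [diagForm, ← Finset.add_sum_erase _ _ (Finset.mem_univ i₀)]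
    have hrest : |∑ i ∈ Finset.univ.erase i₀, lam i * ‖w i‖ ^ 2| ≤ K * (1 - x) := by
      rw [← hsplit, Finset.mul_sum]
      refine (Finset.abs_sum_le_sum_abs _ _).trans (Finset.sum_le_sum fun i _ => ?_)
      rw [abs_mul, abs_of_nonneg (sq_nonneg ‖w i‖)]
      exact mul_le_mul_of_nonneg_right (hi₀ i) (sq_nonneg _)
    have hmain : K * x ≤ η + K * (1 - x) := by
      have h3 : |lam i₀ * x| ≤ |diagForm lam w| +
          |∑ i ∈ Finset.univ.erase i₀, lam i * ‖w i‖ ^ 2| := by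
        have : lam i₀ * x = diagForm lam w -
          ∑ i ∈ Finset.univ.erase i₀, lam i * ‖w i‖ ^ 2 := by rw [hdf]; ring
        rw [this]
        exact abs_sub _ _
      rw [abs_mul, abs_of_nonneg (by linarith : 0 ≤ x)] at h3
      linarith
    have := (le_abs_self (lam j)).trans (hi₀ j)
    nlinarith
  have hdecomp : ((2 * η : ℝ) : ℂ) • (1 : Matrix ι ι ℂ) - H =
      ((V : Matrix ι ι ℂ)ᴴ)ᴴ * Matrix.diagonal (fun i => ((2 * η - lam i : ℝ) : ℂ)) *
        (V : Matrix ι ι ℂ)ᴴ := by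
    have hd : Matrix.diagonal (fun i => ((2 * η - lam i : ℝ) : ℂ)) =
        ((2 * η : ℝ) : ℂ) • (1 : Matrix ι ι ℂ) - Matrix.diagonal (fun i => (lam i : ℂ)) := by
      rw [Matrix.smul_one_eq_diagonal, Matrix.diagonal_sub]
      simp
    rw [Matrix.conjTranspose_conjTranspose, hd, Matrix.mul_sub, Matrix.sub_mul, ← hspec,
      Matrix.mul_smul, Matrix.mul_one, Matrix.smul_mul, hVV]
  rw [hdecomp]
  exact posSemidef_conj_diagonal _ fun i => by linarith [hbound i]

/-- In an eigenbasis of `E` the trace is a sum of eigenvalues of `E` times diagonal entries of a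
conjugate of `K`, all nonnegative. -/
lemma outcomeProb_nonneg {E K : Matrix ι ι ℂ} (hE : E.PosSemidef) (hK : K.PosSemidef) :
    0 ≤ outcomeProb E K := by
  have hspec := IsHermitian_eq_conj_diagonal hE.1
  set V := (hE.1.eigenvectorUnitary : Matrix ι ι ℂ)
  have hK' := hK.conjTranspose_mul_mul_same V
  have h : ∀ G : Matrix ι ι ℂ, (V * G * Vᴴ * K).trace = (G * (Vᴴ * K * V)).trace := fun G => by
    rw [Matrix.mul_assoc (V * G), Matrix.mul_assoc V, Matrix.trace_mul_comm V]
    simp only [Matrix.mul_assoc]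
  rw [outcomeProb, hspec, h, Matrix.trace, Complex.re_sum]
  refine Finset.sum_nonneg fun i _ => ?_
  rw [Matrix.diag_apply, Matrix.diagonal_mul, Complex.re_ofReal_mul]
  exact mul_nonneg (hE.eigenvalues_nonneg i) (Complex.le_def.1 (hK'.diag_nonneg (i := i))).1

end Net

/-! ### Averages of conjugates -/

section AvgConj

variable {ι : Type} [Fintype ι] [DecidableEq ι] {t : ℕ}

/-- `1 / t ∑ₖ Uₖ† D Uₖ` for a real diagonal matrix `D`. -/
def avgConj (U : Fin t → Matrix.unitaryGroup ι ℂ) : (ι → ℝ) →ₗ[ℝ] Matrix ι ι ℂ where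
  toFun D := (1 / (t : ℂ)) • ∑ k, (U k : Matrix ι ι ℂ)ᴴ *
    Matrix.diagonal (fun i => (D i : ℂ)) * (U k : Matrix ι ι ℂ)
  map_add' D D' := by
    have : Matrix.diagonal (fun i => (((D + D') i : ℝ) : ℂ)) =
        Matrix.diagonal (fun i => (D i : ℂ)) + Matrix.diagonal (fun i => (D' i : ℂ)) := by
      rw [Matrix.diagonal_add]; simp
    simp only [this, Matrix.mul_add, Matrix.add_mul, Finset.sum_add_distrib, smul_add]
  map_smul' c D := by
    have : Matrix.diagonal (fun i => (((c • D) i : ℝ) : ℂ)) =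
        c • Matrix.diagonal (fun i => (D i : ℂ)) := by
      rw [← Matrix.diagonal_smul]; congr 1; ext i; simp
    simp only [this, Matrix.mul_smul, Matrix.smul_mul, ← Finset.smul_sum, RingHom.id_apply]
    rw [smul_comm]

lemma avgConj_apply (U : Fin t → Matrix.unitaryGroup ι ℂ) (D : ι → ℝ) :
    avgConj U D = (1 / (t : ℂ)) • ∑ k, (U k : Matrix ι ι ℂ)ᴴ *
      Matrix.diagonal (fun i => (D i : ℂ)) * (U k : Matrix ι ι ℂ) := rfl

lemma avgConj_isHermitian (U : Fin t → Matrix.unitaryGroup ι ℂ) (D : ι → ℝ) :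
    (avgConj U D).IsHermitian := by
  rw [avgConj_apply, Matrix.IsHermitian, Matrix.conjTranspose_smul, Matrix.conjTranspose_sum]
  congr 1
  · simp
  · refine Finset.sum_congr rfl fun k _ => ?_
    simp only [Matrix.conjTranspose_mul, Matrix.conjTranspose_conjTranspose,
      Matrix.diagonal_conjTranspose, Matrix.mul_assoc]
    congr 3
    ext i
    simp

lemma avgConj_posSemidef (U : Fin t → Matrix.unitaryGroup ι ℂ) {D : ι → ℝ} (hD : ∀ i, 0 ≤ D i) :
    (avgConj U D).PosSemidef := by
  rw [avgConj_apply]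
  refine Matrix.PosSemidef.smul (Matrix.posSemidef_sum _ fun k _ => posSemidef_conj_diagonal _ hD) ?_
  rw [one_div]
  exact inv_nonneg.2 (Nat.cast_nonneg t)

lemma avgConj_one (ht : 0 < t) (U : Fin t → Matrix.unitaryGroup ι ℂ) :
    avgConj U (fun _ => 1) = 1 := by
  have h : ∀ k, (U k : Matrix ι ι ℂ)ᴴ * (U k : Matrix ι ι ℂ) = 1 := fun k => by
    rw [← Matrix.star_eq_conjTranspose]; exact Unitary.coe_star_mul_self (U k)
  have ht' : (t : ℂ) ≠ 0 := by exact_mod_cast ht.ne'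
  rw [avgConj_apply]
  simp [h, smul_smul, ← Nat.cast_smul_eq_nsmul ℂ, ht']

lemma trace_avgConj (ht : 0 < t) (U : Fin t → Matrix.unitaryGroup ι ℂ) (D : ι → ℝ) :
    (avgConj U D).trace = ∑ i, (D i : ℂ) := by
  have h : ∀ k, (U k : Matrix ι ι ℂ) * (U k : Matrix ι ι ℂ)ᴴ = 1 := fun k => by
    rw [← Matrix.star_eq_conjTranspose]; exact Unitary.coe_mul_star_self (U k)
  have ht' : (t : ℂ) ≠ 0 := by exact_mod_cast ht.ne'
  rw [avgConj_apply, Matrix.trace_smul, Matrix.trace_sum]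
  have h2 : ∀ k, ((U k : Matrix ι ι ℂ)ᴴ * Matrix.diagonal (fun i => (D i : ℂ)) *
      (U k : Matrix ι ι ℂ)).trace = ∑ i, (D i : ℂ) := fun k => by
    rw [Matrix.mul_assoc, Matrix.trace_mul_comm, Matrix.mul_assoc, h, Matrix.mul_one,
      Matrix.trace_diagonal]
  simp [h2, ht']

lemma re_dotProduct_avgConj (U : Fin t → Matrix.unitaryGroup ι ℂ) (D : ι → ℝ) (φ : ι → ℂ) :
    (star φ ⬝ᵥ (avgConj U D *ᵥ φ)).re =
      1 / t * ∑ k, diagForm D ((U k : Matrix ι ι ℂ) *ᵥ φ) := by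
  rw [avgConj_apply, Matrix.smul_mulVec, dotProduct_smul, Matrix.sum_mulVec, dotProduct_sum]
  have : (1 / (t : ℂ)) = ((1 / t : ℝ) : ℂ) := by push_cast; rfl
  rw [this, smul_eq_mul, Complex.re_ofReal_mul, Complex.re_sum]
  simp only [re_dotProduct_conj_diagonal]

lemma continuous_avgConj (D : ι → ℝ) :
    Continuous fun U : Fin t → Matrix.unitaryGroup ι ℂ => avgConj U D := by
  simp only [avgConj_apply]
  refine Continuous.const_smul (continuous_finsetSum Finset.univ fun k _ => ?_) (1 / (t : ℂ))
  have h : Continuous fun U : Fin t → Matrix.unitaryGroup ι ℂ => (U k : Matrix ι ι ℂ) :=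
    continuous_unitary_coe.comp (continuous_apply k)
  exact (h.matrix_conjTranspose.matrix_mul continuous_const).matrix_mul h

/-- With overwhelming probability, the averages of conjugates of finitely many centred diagonal
matrices are small in operator norm. -/
lemma measure_avgConj_deviation_le (ht : 0 < t) (𝒟 : Finset (ι → ℝ))
    (hD0 : ∀ D ∈ 𝒟, ∑ i, D i = 0) (hD : ∀ D ∈ 𝒟, ∀ i, |D i| ≤ 2)
    {η : ℝ} (hη0 : 0 ≤ η) (hη : η ≤ 2) :
    (Measure.pi fun _ : Fin t => haarUnitary ι).real
      {U | ¬ ∀ D ∈ 𝒟, (((2 * η : ℝ) : ℂ) • (1 : Matrix ι ι ℂ) - avgConj U D).PosSemidef} ≤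
      𝒟.card * 5 ^ (2 * Fintype.card ι) *
        (2 * Real.exp (-(t * Fintype.card ι * η ^ 2 / 16))) := by
  obtain ⟨S, hcard, hS1, hS⟩ := exists_sphere_net ι
  set ν := Measure.pi fun _ : Fin t => haarUnitary ι with hν
  set e := Real.exp (-(t * Fintype.card ι * η ^ 2 / 16)) with he
  have htpos : (0 : ℝ) < t := by exact_mod_cast ht
  -- The net argument needs the modulus of the form, so each one-sided tail is used for both `D` and
  -- `-D`.
  let bad : (ι → ℝ) → (ι → ℂ) → Set (Fin t → Matrix.unitaryGroup ι ℂ) := fun D φ =>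
    {U | t * η ≤ ∑ k, diagForm D ((U k : Matrix ι ι ℂ) *ᵥ φ)}
  have hbad : ∀ D ∈ 𝒟, ∀ φ ∈ S, ν.real (bad D φ ∪ bad (-D) φ) ≤ 2 * e := by
    intro D hDm φ hφ
    have h1 := measure_avg_diagForm_ge_le t D (hD0 D hDm) (hD D hDm) φ (hS1 φ hφ) hη0 hη
    have h2 := measure_avg_diagForm_ge_le t (-D) (by simp [hD0 D hDm])
      (fun i => by simpa using hD D hDm i) φ (hS1 φ hφ) hη0 hη
    calc ν.real (bad D φ ∪ bad (-D) φ) ≤ ν.real (bad D φ) + ν.real (bad (-D) φ) :=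
          measureReal_union_le _ _
      _ ≤ e + e := add_le_add h1 h2
      _ = 2 * e := by ring
  have hsub : {U : Fin t → Matrix.unitaryGroup ι ℂ | ¬ ∀ D ∈ 𝒟,
      (((2 * η : ℝ) : ℂ) • (1 : Matrix ι ι ℂ) - avgConj U D).PosSemidef} ⊆
      ⋃ q ∈ 𝒟 ×ˢ S, (bad q.1 q.2 ∪ bad (-q.1) q.2) := by
    intro U hU
    by_contra hcon
    refine hU fun D hDm => posSemidef_of_net hS1 hS (avgConj_isHermitian U D) fun φ hφ => ?_
    simp only [Set.mem_iUnion, not_exists] at hcon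
    have h := hcon (D, φ) (Finset.mem_product.2 ⟨hDm, hφ⟩)
    simp only [Set.mem_union, not_or, bad, Set.mem_ofPred_eq, not_le] at h
    obtain ⟨h1, h2⟩ := h
    have h3 : ∀ w : ι → ℂ, diagForm (-D) w = -diagForm D w := fun w => by
      simp [diagForm]
    simp only [h3, Finset.sum_neg_distrib] at h2
    rw [re_dotProduct_avgConj, abs_le]
    constructor
    · rw [one_div, ← neg_le_neg_iff, neg_neg, ← mul_neg, inv_mul_le_iff₀ htpos]; exact h2.le
    · rw [one_div, inv_mul_le_iff₀ htpos]; exact h1.le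
  calc ν.real _ ≤ ν.real (⋃ q ∈ 𝒟 ×ˢ S, (bad q.1 q.2 ∪ bad (-q.1) q.2)) :=
        measureReal_mono hsub (measure_ne_top _ _)
    _ ≤ ∑ q ∈ 𝒟 ×ˢ S, ν.real (bad q.1 q.2 ∪ bad (-q.1) q.2) := measureReal_biUnion_finset_le _ _
    _ ≤ ∑ _q ∈ 𝒟 ×ˢ S, 2 * e := Finset.sum_le_sum fun q hq =>
        hbad q.1 (Finset.mem_product.1 hq).1 q.2 (Finset.mem_product.1 hq).2
    _ = 𝒟.card * S.card * (2 * e) := by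
        rw [Finset.sum_const, Finset.card_product, nsmul_eq_mul]; push_cast; ring
    _ ≤ 𝒟.card * 5 ^ (2 * Fintype.card ι) * (2 * e) := by
        have : (S.card : ℝ) ≤ 5 ^ (2 * Fintype.card ι) := by exact_mod_cast hcard
        have he0 : 0 ≤ e := (Real.exp_pos _).le
        gcongr

end AvgConj

/-! ### Outcome probabilities -/

section Outcome

variable {ι : Type} [Fintype ι] [DecidableEq ι]

/-- `outcomeProb` as a real linear functional of the state. -/
def outcomeProbLM (E : Matrix ι ι ℂ) : Matrix ι ι ℂ →ₗ[ℝ] ℝ where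
  toFun K := outcomeProb E K
  map_add' A B := by simp [outcomeProb, Matrix.mul_add]
  map_smul' c A := by simp [outcomeProb]

lemma outcomeProbLM_apply (E K : Matrix ι ι ℂ) : outcomeProbLM E K = outcomeProb E K := rfl

lemma outcomeProb_one (E : Matrix ι ι ℂ) : outcomeProb E 1 = E.trace.re := by
  rw [outcomeProb, Matrix.mul_one]

lemma outcomeProb_ofReal_smul {ι : Type} [Fintype ι] (E K : Matrix ι ι ℂ) (c : ℝ) :
    outcomeProb E ((c : ℂ) • K) = c * outcomeProb E K := by
  rw [outcomeProb, outcomeProb, Matrix.mul_smul, Matrix.trace_smul, smul_eq_mul,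
    Complex.re_ofReal_mul]

/-- The diagonal block of an operator on `C` that belongs to the prime `p`. -/
def primeBlock {P : Finset ℕ} {dB : ℕ} (E : Matrix (BasisC P dB) (BasisC P dB) ℂ) (p : P) :
    Matrix (BasisAB p.1 dB) (BasisAB p.1 dB) ℂ :=
  E.submatrix (fun i => ⟨p, i⟩) (fun i => ⟨p, i⟩)

/-- The fingerprint is block diagonal, so a measurement sees only its own diagonal blocks. This
reduces both properties to single primes. -/
lemma outcomeProb_fingerprint {n : ℕ} (P : Finset ℕ) (t dB : ℕ) (U : UnitaryFamily P t dB)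
    (E : Matrix (BasisC P dB) (BasisC P dB) ℂ) (x : Fin (2 ^ n)) :
    outcomeProb E (fingerprint P t dB U x) =
      1 / P.card * ∑ p : P, outcomeProb (primeBlock E p)
        (lockedState p.1 t dB (U p) x) := by
  have h1 : (1 / (P.card : ℂ)) = ((1 / P.card : ℝ) : ℂ) := by push_cast; rfl
  rw [fingerprint, h1, outcomeProb_ofReal_smul]
  congr 1
  simp only [outcomeProb, Matrix.trace, Matrix.diag_apply, Matrix.mul_apply, Fintype.sum_sigma,
    Complex.re_sum]
  refine Finset.sum_congr rfl fun p _ => Finset.sum_congr rfl fun i _ => ?_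
  rw [Finset.sum_eq_single p]
  · refine Finset.sum_congr rfl fun j _ => ?_
    rw [Matrix.blockDiagonal'_apply_eq]
    rfl
  · intro q _ hq
    refine Finset.sum_eq_zero fun j _ => ?_
    rw [Matrix.blockDiagonal'_apply_ne _ _ _ hq, mul_zero, Complex.zero_re]
  · simp

end Outcome

/-! ### The locked state -/

section Locked

variable {p t dB : ℕ}

/-- The indicator of the basis vectors of `A ⊗ B` with label `a` on `A`. -/
def labelIndicator (p dB a : ℕ) : BasisAB p dB → ℝ := fun i => if i.1.val = a then 1 else 0

/-- Summing `|b⟩⟨b|` over the basis of `B` leaves a diagonal projection, which makes the state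
linear in a label indicator. -/
lemma lockedState_eq (U : Fin t → Matrix.unitaryGroup (BasisAB p dB) ℂ) (x : ℕ) :
    lockedState p t dB U x =
      ((1 / dB : ℝ) : ℂ) • avgConj U (labelIndicator p dB (x % p)) := by
  have h : ∀ k, ∑ b : Fin dB, (U k : Matrix (BasisAB p dB) (BasisAB p dB) ℂ)ᴴ *
      Matrix.of (fun i j : BasisAB p dB =>
        if (i.1.val = x % p ∧ i.2 = b) ∧ (j.1.val = x % p ∧ j.2 = b) then (1 : ℂ) else 0) *
      (U k : Matrix (BasisAB p dB) (BasisAB p dB) ℂ) =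
      (U k : Matrix (BasisAB p dB) (BasisAB p dB) ℂ)ᴴ *
        Matrix.diagonal (fun i => (labelIndicator p dB (x % p) i : ℂ)) *
        (U k : Matrix (BasisAB p dB) (BasisAB p dB) ℂ) := by
    intro k
    rw [← Finset.sum_mul, ← Finset.mul_sum]
    congr 2
    ext i j
    rw [Matrix.sum_apply]
    simp only [Matrix.of_apply, Matrix.diagonal_apply, labelIndicator]
    by_cases hij : i = j
    · subst hij
      by_cases hi : i.1.val = x % p <;> simp [hi]
    · rw [if_neg hij]
      refine Finset.sum_eq_zero fun b _ => if_neg ?_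
      rintro ⟨⟨h1, h2⟩, h3, h4⟩
      exact hij (Prod.ext (Fin.ext (h1.trans h3.symm)) (h2.trans h4.symm))
  rw [lockedState, avgConj_apply, smul_smul]
  simp only [h]
  congr 1
  push_cast
  field_simp

lemma lockedState_mod (U : Fin t → Matrix.unitaryGroup (BasisAB p dB) ℂ) (x : ℕ) :
    lockedState p t dB U (x % p) = lockedState p t dB U x := by
  rw [lockedState_eq, lockedState_eq, Nat.mod_mod]

lemma lockedState_posSemidef (U : Fin t → Matrix.unitaryGroup (BasisAB p dB) ℂ) (x : ℕ) :
    (lockedState p t dB U x).PosSemidef := by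
  rw [lockedState_eq]
  refine (avgConj_posSemidef U fun i => ?_).smul ?_
  · rw [labelIndicator]; split_ifs <;> norm_num
  · exact Complex.zero_le_real.2 (by positivity)

lemma trace_lockedState (hp : 0 < p) (ht : 0 < t) (hdB : 0 < dB)
    (U : Fin t → Matrix.unitaryGroup (BasisAB p dB) ℂ) (x : ℕ) :
    (lockedState p t dB U x).trace = 1 := by
  rw [lockedState_eq, Matrix.trace_smul, trace_avgConj ht, Fintype.sum_prod_type,
    Finset.sum_eq_single (⟨x % p, Nat.mod_lt x hp⟩ : Fin p)]
  · have : (dB : ℂ) ≠ 0 := by exact_mod_cast hdB.ne'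
    simp [labelIndicator, this]
  · intro a _ ha
    refine Finset.sum_eq_zero fun b _ => ?_
    have : a.val ≠ x % p := fun h => ha (Fin.ext h)
    simp [labelIndicator, this]
  · simp

lemma continuous_lockedState (x : ℕ) :
    Continuous fun U : Fin t → Matrix.unitaryGroup (BasisAB p dB) ℂ => lockedState p t dB U x := by
  simp only [lockedState_eq]
  exact (continuous_avgConj (labelIndicator p dB (x % p))).const_smul ((1 / dB : ℝ) : ℂ)

lemma sum_labelIndicator :
    ∑ a : Fin p, labelIndicator p dB a = fun _ : BasisAB p dB => (1 : ℝ) := by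
  ext i
  simp only [Finset.sum_apply, labelIndicator, ← Fin.ext_iff]
  simp

/-- The centred diagonal matrix with the value `s a` on the label `a`. -/
def signDiag (dB : ℕ) (s : Fin p → ℝ) : BasisAB p dB → ℝ := fun i => s i.1 - 1 / p * ∑ a, s a

lemma signDiag_eq (s : Fin p → ℝ) :
    signDiag dB s = ∑ a : Fin p, s a • (labelIndicator p dB a - (1 / p : ℝ) • fun _ => 1) := by
  ext i
  simp only [signDiag, Finset.sum_apply, Pi.smul_apply, Pi.sub_apply, smul_eq_mul, mul_sub,
    Finset.sum_sub_distrib, mul_one]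
  rw [← Finset.sum_mul, mul_comm (1 / (p : ℝ))]
  simp only [labelIndicator, ← Fin.ext_iff]
  simp

lemma sum_signDiag (hp : 0 < p) (s : Fin p → ℝ) : ∑ i, signDiag dB s i = 0 := by
  have hp' : (p : ℝ) ≠ 0 := by exact_mod_cast hp.ne'
  rw [Fintype.sum_prod_type]
  simp only [signDiag, Finset.sum_const, Finset.card_univ,
    Fintype.card_fin, nsmul_eq_mul, Finset.sum_sub_distrib, ← Finset.mul_sum]
  field_simp
  ring

/-- The sign patterns on the labels of `A`. -/
def signPatterns (p : ℕ) : Finset (Fin p → ℝ) := Fintype.piFinset fun _ => {1, -1}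

lemma card_signPatterns_le (p : ℕ) : (signPatterns p).card ≤ 2 ^ p := by
  rw [signPatterns, Fintype.card_piFinset]
  refine (Finset.prod_le_prod' fun _ _ => Finset.card_le_two).trans ?_
  simp

lemma abs_signDiag_le (hp : 0 < p) {s : Fin p → ℝ} (hs : s ∈ signPatterns p)
    (i : BasisAB p dB) : |signDiag dB s i| ≤ 2 := by
  have hp' : (0 : ℝ) < p := by exact_mod_cast hp
  have h1 : ∀ a, |s a| = 1 := fun a => by
    have := Fintype.mem_piFinset.1 hs a
    rcases Finset.mem_insert.1 this with h | h
    · simp [h]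
    · simp [Finset.mem_singleton.1 h]
  have h2 : |∑ a, s a| ≤ p := (Finset.abs_sum_le_sum_abs _ _).trans (by simp [h1])
  rw [signDiag]
  refine (abs_sub _ _).trans ?_
  rw [h1, abs_mul, abs_of_nonneg (by positivity)]
  have : 1 / (p : ℝ) * |∑ a, s a| ≤ 1 := by
    rw [one_div, inv_mul_le_iff₀ hp', mul_one]; exact h2
  linarith

/-- The locked states are indistinguishable from the maximally mixed state on average. -/
def LocksWell (p t dB : ℕ) (β : ℝ) (U : Fin t → Matrix.unitaryGroup (BasisAB p dB) ℂ) : Prop :=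
  ∀ E : Matrix (BasisAB p dB) (BasisAB p dB) ℂ, E.PosSemidef →
    ∑ a : Fin p, |outcomeProb E (lockedState p t dB U a) - E.trace.re / (p * dB)| ≤
      β * p * (E.trace.re / (p * dB))

/-- Duality between the `ℓ¹` norm and signs: with `s` the signs of the deviations, their absolute
sum is, up to the factor `dB`, the pairing of `E` with `avgConj U (signDiag dB s)`, an operator
dominated by `β`. The operator bounds form a finite list, whereas `E` is arbitrary. -/
lemma locksWell_of_signPatterns (hp : 0 < p) (ht : 0 < t) (hdB : 0 < dB) {β : ℝ}
    {U : Fin t → Matrix.unitaryGroup (BasisAB p dB) ℂ}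
    (hU : ∀ s ∈ signPatterns p, ((β : ℂ) • (1 : Matrix (BasisAB p dB) (BasisAB p dB) ℂ) -
      avgConj U (signDiag dB s)).PosSemidef) : LocksWell p t dB β U := by
  intro E hE
  have hp' : (0 : ℝ) < p := by exact_mod_cast hp
  have hd' : (0 : ℝ) < dB := by exact_mod_cast hdB
  set v : Fin p → ℝ := fun a =>
    outcomeProb E (lockedState p t dB U a) - E.trace.re / (p * dB) with hv
  set s : Fin p → ℝ := fun a => if 0 ≤ v a then 1 else -1 with hs
  have hsm : s ∈ signPatterns p := Fintype.mem_piFinset.2 fun a => by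
    simp only [hs]; split_ifs <;> simp
  have habs : ∀ a, |v a| = s a * v a := fun a => by
    simp only [hs]
    split_ifs with h
    · rw [abs_of_nonneg h, one_mul]
    · rw [abs_of_neg (not_le.1 h)]; ring
  have h1 := outcomeProb_nonneg hE (hU s hsm)
  have h2 : outcomeProb E ((β : ℂ) • (1 : Matrix (BasisAB p dB) (BasisAB p dB) ℂ) -
      avgConj U (signDiag dB s)) = β * E.trace.re - dB * ∑ a, s a * v a := by
    rw [← outcomeProbLM_apply, map_sub, outcomeProbLM_apply, outcomeProb_ofReal_smul,
      outcomeProb_one, signDiag_eq, map_sum, map_sum, Finset.mul_sum]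
    congr 1
    refine Finset.sum_congr rfl fun a _ => ?_
    rw [map_smul, map_smul, map_sub, map_sub, map_smul, map_smul, avgConj_one ht,
      outcomeProbLM_apply, outcomeProbLM_apply, outcomeProb_one]
    simp only [hv]
    rw [lockedState_eq, outcomeProb_ofReal_smul, Nat.mod_eq_of_lt a.2, smul_eq_mul, smul_eq_mul]
    field_simp
  rw [h2] at h1
  have h3 : ∑ a, |v a| = ∑ a, s a * v a := Finset.sum_congr rfl fun a _ => habs a
  change ∑ a, |v a| ≤ _
  rw [h3]
  have h4 : β * p * (E.trace.re / (p * dB)) = β * E.trace.re / dB := by field_simp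
  rw [h4, le_div_iff₀ hd']
  linarith

/-- With `η = ε / 8` and `t ε² ≥ 16384 = 16 · 16 · 64` the tail at one vector is `exp (-16 d)`,
where `d = p dB`. Sign patterns, net and the factor 2 for both tails cost at most `2 ^ d · 25 ^ d ·
2 ^ d = 100 ^ d ≤ exp (5 d)`. -/
lemma measure_not_locksWell_le (hp : 0 < p) (ht : 0 < t) (hdB : 0 < dB) {ε : ℝ} (hε0 : 0 < ε)
    (hε : ε < 1 / 4) (htε : 16384 ≤ t * ε ^ 2) :
    (Measure.pi fun _ : Fin t => haarUnitary (BasisAB p dB)).real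
      {U | ¬ LocksWell p t dB (ε / 4) U} ≤ Real.exp (-(10 * p)) := by
  classical
  set 𝒟 : Finset (BasisAB p dB → ℝ) := (signPatterns p).image (signDiag dB) with h𝒟
  have hcard : (𝒟.card : ℝ) ≤ 2 ^ p := by
    exact_mod_cast Finset.card_image_le.trans (card_signPatterns_le p)
  have h := measure_avgConj_deviation_le (ι := BasisAB p dB) ht 𝒟
    (fun D hD => by
      obtain ⟨s, -, rfl⟩ := Finset.mem_image.1 hD
      exact sum_signDiag hp s)
    (fun D hD i => by
      obtain ⟨s, hs, rfl⟩ := Finset.mem_image.1 hD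
      exact abs_signDiag_le hp hs i) (η := ε / 8) (by linarith) (by linarith)
  have hsub : {U | ¬ LocksWell p t dB (ε / 4) U} ⊆ {U | ¬ ∀ D ∈ 𝒟,
      (((2 * (ε / 8) : ℝ) : ℂ) • (1 : Matrix (BasisAB p dB) (BasisAB p dB) ℂ) -
        avgConj U D).PosSemidef} := by
    intro U hU hcon
    refine hU (locksWell_of_signPatterns hp ht hdB fun s hs => ?_)
    have := hcon _ (Finset.mem_image_of_mem _ hs)
    rwa [show 2 * (ε / 8) = ε / 4 by ring] at this
  refine (measureReal_mono hsub (measure_ne_top _ _)).trans (h.trans ?_)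
  set d := Fintype.card (BasisAB p dB) with hd
  have hdp : d = p * dB := by simp [hd, BasisAB]
  have hpd : p ≤ d := by rw [hdp]; exact Nat.le_mul_of_pos_right p hdB
  have hpd' : (p : ℝ) ≤ d := by exact_mod_cast hpd
  have hd1 : 1 ≤ d := by omega
  have hexp : Real.exp (-(t * d * (ε / 8) ^ 2 / 16)) ≤ Real.exp (-(16 * d)) := by
    rw [Real.exp_le_exp, neg_le_neg_iff]
    have : (t * d * (ε / 8) ^ 2 / 16 : ℝ) = t * ε ^ 2 * d / 1024 := by ring
    rw [this, le_div_iff₀ (by norm_num)]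
    nlinarith [mul_le_mul_of_nonneg_right htε (Nat.cast_nonneg (α := ℝ) d)]
  have he5 : (100 : ℝ) ≤ Real.exp 5 := by
    have h1 : (2.7 : ℝ) ≤ Real.exp 1 := by linarith [Real.exp_one_gt_d9]
    have h2 : Real.exp 5 = Real.exp 1 ^ 5 := by rw [← Real.exp_nat_mul]; norm_num
    rw [h2]
    calc (100 : ℝ) ≤ 2.7 ^ 5 := by norm_num
      _ ≤ _ := by gcongr
  calc (𝒟.card : ℝ) * 5 ^ (2 * d) * (2 * Real.exp (-(t * d * (ε / 8) ^ 2 / 16)))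
      ≤ 2 ^ d * 5 ^ (2 * d) * (2 ^ d * Real.exp (-(16 * d))) := by
        have h2d : (2 : ℝ) ≤ 2 ^ d := by
          calc (2 : ℝ) = 2 ^ 1 := by norm_num
            _ ≤ 2 ^ d := pow_le_pow_right₀ (by norm_num) hd1
        have h2p : (𝒟.card : ℝ) ≤ 2 ^ d := hcard.trans (pow_le_pow_right₀ (by norm_num) hpd)
        gcongr
    _ = 100 ^ d * Real.exp (-(16 * d)) := by
        rw [← mul_assoc, pow_mul, ← mul_pow, ← mul_pow]; norm_num
    _ ≤ Real.exp 5 ^ d * Real.exp (-(16 * d)) := by gcongr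
    _ = Real.exp (-(11 * d)) := by
        rw [← Real.exp_nat_mul, ← Real.exp_add]; congr 1; ring
    _ ≤ Real.exp (-(10 * p)) := by
        rw [Real.exp_le_exp]; nlinarith [Nat.cast_nonneg (α := ℝ) d]

end Locked

/-! ### The hiding property -/

section Hiding

lemma sum_range_mul_mod (g : ℕ → ℝ) (p k : ℕ) :
    ∑ x ∈ Finset.range (p * k), g (x % p) = k * ∑ a ∈ Finset.range p, g a := by
  induction k with
  | zero => simp
  | succ k ih =>
    rw [Nat.mul_succ, Finset.sum_range_add, ih]
    push_cast
    rw [add_mul, one_mul]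
    congr 1
    refine Finset.sum_congr rfl fun a ha => ?_
    rw [Nat.mul_add_mod, Nat.mod_eq_of_lt (Finset.mem_range.1 ha)]

lemma sum_range_mod_le {g : ℕ → ℝ} (hg : ∀ a, 0 ≤ g a) {p N : ℕ} (hp : 0 < p) (hpN : p ≤ N) :
    ∑ x ∈ Finset.range N, g (x % p) ≤ 2 * N / p * ∑ a ∈ Finset.range p, g a := by
  have hp' : (0 : ℝ) < p := by exact_mod_cast hp
  have hN : N ≤ p * (N / p + 1) := by
    have := Nat.div_add_mod N p
    have := Nat.mod_lt N hp
    rw [Nat.mul_add]; omega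
  calc ∑ x ∈ Finset.range N, g (x % p)
      -- Rounding up to whole periods at most doubles the average count `N / p`, because `N / p ≥
      -- 1`.
      ≤ ∑ x ∈ Finset.range (p * (N / p + 1)), g (x % p) :=
        Finset.sum_le_sum_of_subset_of_nonneg (Finset.range_subset_range.2 hN) fun _ _ _ => hg _
    _ = ((N / p + 1 : ℕ) : ℝ) * ∑ a ∈ Finset.range p, g a := sum_range_mul_mod g p _
    _ ≤ 2 * N / p * ∑ a ∈ Finset.range p, g a := by
        refine mul_le_mul_of_nonneg_right ?_ (Finset.sum_nonneg fun a _ => hg a)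
        have h1 : ((N / p : ℕ) : ℝ) ≤ N / p := Nat.cast_div_le
        have h2 : (1 : ℝ) ≤ N / p := by
          rw [le_div_iff₀ hp', one_mul]; exact_mod_cast hpN
        push_cast
        rw [mul_div_assoc]
        linarith

/-- A nonnegative weight that is close to a constant in `ℓ¹` normalizes to a nearly uniform
distribution. -/
lemma half_sum_abs_normalize_sub_le {N : ℕ} {r : Fin N → ℝ} {W ε : ℝ} (hε0 : 0 < ε)
    (hε : ε < 1 / 4) (hW : 0 ≤ W) (hr : ∑ x, |r x - W| ≤ ε / 2 * N * W) (hR : ∑ x, r x ≠ 0) :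
    1 / 2 * ∑ x, |r x / (∑ y, r y) - 1 / N| ≤ ε := by
  set R := ∑ x, r x with hRdef
  have hN : (N : ℝ) ≠ 0 := by
    intro h
    have : N = 0 := by exact_mod_cast h
    subst this
    exact hR (by simp [hRdef])
  have hNpos : (0 : ℝ) < N := lt_of_le_of_ne (Nat.cast_nonneg N) hN.symm
  have hdiff : |R - N * W| ≤ ε / 2 * N * W := by
    have : R - N * W = ∑ x, (r x - W) := by
      rw [Finset.sum_sub_distrib]; simp [hRdef]
    rw [this]
    exact (Finset.abs_sum_le_sum_abs _ _).trans hr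
  have hWpos : 0 < W := by
    rcases hW.eq_or_lt with h | h
    · rw [← h] at hdiff
      simp at hdiff
      exact absurd hdiff hR
    · exact h
  have hNW : 0 < N * W := by positivity
  obtain ⟨h1, h2⟩ := abs_le.1 hdiff
  have hRlow : (1 - ε / 2) * (N * W) ≤ R := by linarith
  have hRpos : 0 < R := lt_of_lt_of_le (by apply mul_pos _ hNW; linarith) hRlow
  have hterm : ∀ x, |r x / R - 1 / N| ≤ |r x - W| / R + |N * W - R| / (N * R) := by
    intro x
    have : r x / R - 1 / N = (r x - W) / R + (N * W - R) / (N * R) := by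
      field_simp
      ring
    rw [this]
    refine (abs_add_le _ _).trans (le_of_eq ?_)
    rw [abs_div, abs_div, abs_of_pos hRpos, abs_of_pos (mul_pos hNpos hRpos)]
  have hsum : ∑ x, |r x / R - 1 / N| ≤ (ε * N * W) / R := by
    calc ∑ x, |r x / R - 1 / N| ≤ ∑ x, (|r x - W| / R + |N * W - R| / (N * R)) :=
          Finset.sum_le_sum fun x _ => hterm x
      _ = (∑ x, |r x - W| + |N * W - R|) / R := by
          rw [Finset.sum_add_distrib, ← Finset.sum_div]
          simp only [Finset.sum_const, Finset.card_univ, Fintype.card_fin, nsmul_eq_mul]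
          field_simp
      _ ≤ (ε * N * W) / R := by
          rw [abs_sub_comm]
          gcongr
          linarith
  -- The total weight `R` is at least `(1 - ε / 2) N W`, hence at least half of `N W`.
  have : ε * N * W / R ≤ 2 * ε := by
    rw [div_le_iff₀ hRpos]
    nlinarith [mul_pos hε0 hNW]
  linarith

/-- For each prime the deviation from the value `w p` on the maximally mixed state is periodic in
`x`, so the bound over labels becomes one over strings, with `ε / 4` doubled to `ε / 2`. Averaging
over `p` shows that the outcome weight is close to a constant `W` in `ℓ¹`, and the posterior is that
weight normalized. -/
lemma hides_of_locksWell {n : ℕ} {ε : ℝ} (hε0 : 0 < ε) (hε : ε < 1 / 4) (P : Finset ℕ) {t dB : ℕ}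
    (U : UnitaryFamily P t dB) (hP : ∀ p ∈ P, 0 < p ∧ p ≤ 2 ^ n)
    (hU : ∀ p : P, LocksWell p.1 t dB (ε / 4) (U p))
    {E : Matrix (BasisC P dB) (BasisC P dB) ℂ} (hE : E.PosSemidef)
    (hne : avgOutcomeProb (fingerprint (n := n) P t dB U) E ≠ 0) :
    traceDist (posterior (fingerprint (n := n) P t dB U) E) (unifBits n) ≤ ε := by
  set r : Fin (2 ^ n) → ℝ := fun x => outcomeProb E (fingerprint P t dB U x) with hr
  let Eb : (p : P) → Matrix (BasisAB p.1 dB) (BasisAB p.1 dB) ℂ :=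
    fun p => primeBlock E p
  have hEb : ∀ p, (Eb p).PosSemidef := fun p => hE.submatrix _
  let w : P → ℝ := fun p => (Eb p).trace.re / (p.1 * dB)
  have hw : ∀ p, 0 ≤ w p := fun p =>
    div_nonneg (Complex.le_def.1 (hEb p).trace_nonneg).1 (by positivity)
  set W : ℝ := 1 / P.card * ∑ p, w p with hWdef
  have hW : 0 ≤ W := mul_nonneg (by positivity) (Finset.sum_nonneg fun p _ => hw p)
  have h2n : (0 : ℝ) < 2 ^ n := by positivity
  have hp1 : ∀ p : P, ∑ x : Fin (2 ^ n),
      |outcomeProb (Eb p) (lockedState p.1 t dB (U p) x) - w p| ≤ ε / 2 * 2 ^ n * w p := by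
    intro p
    obtain ⟨hp0, hpn⟩ := hP p.1 p.2
    have hp' : (0 : ℝ) < p.1 := by exact_mod_cast hp0
    let g : ℕ → ℝ := fun a => |outcomeProb (Eb p) (lockedState p.1 t dB (U p) a) - w p|
    have h1 : ∑ x : Fin (2 ^ n), |outcomeProb (Eb p) (lockedState p.1 t dB (U p) x) - w p| =
        ∑ x ∈ Finset.range (2 ^ n), g (x % p.1) := by
      rw [Finset.sum_range]
      refine Finset.sum_congr rfl fun x _ => ?_
      simp only [g, lockedState_mod]
    have h2 : ∑ a ∈ Finset.range p.1, g a ≤ ε / 4 * p.1 * w p := by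
      rw [Finset.sum_range]
      exact hU p (Eb p) (hEb p)
    rw [h1]
    refine (sum_range_mod_le (g := g) (fun a => abs_nonneg _) hp0 hpn).trans ?_
    calc 2 * ((2 ^ n : ℕ) : ℝ) / p.1 * ∑ a ∈ Finset.range p.1, g a
        ≤ 2 * ((2 ^ n : ℕ) : ℝ) / p.1 * (ε / 4 * p.1 * w p) := by gcongr
      _ = ε / 2 * 2 ^ n * w p := by push_cast; field_simp; ring
  have hdev : ∑ x, |r x - W| ≤ ε / 2 * ((2 ^ n : ℕ) : ℝ) * W := by
    have hx : ∀ x, |r x - W| ≤ 1 / P.card *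
        ∑ p : P, |outcomeProb (Eb p) (lockedState p.1 t dB (U p) x) - w p| := by
      intro x
      have : r x - W = 1 / P.card *
          ∑ p : P, (outcomeProb (Eb p) (lockedState p.1 t dB (U p) x) - w p) := by
        simp only [hr, hWdef]
        rw [outcomeProb_fingerprint, Finset.sum_sub_distrib, mul_sub]
      rw [this, abs_mul, abs_of_nonneg (by positivity)]
      gcongr
      exact Finset.abs_sum_le_sum_abs _ _
    calc ∑ x, |r x - W| ≤ ∑ x : Fin (2 ^ n), 1 / P.card *
          ∑ p : P, |outcomeProb (Eb p) (lockedState p.1 t dB (U p) x) - w p| :=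
          Finset.sum_le_sum fun x _ => hx x
      _ = 1 / P.card * ∑ p : P, ∑ x : Fin (2 ^ n),
          |outcomeProb (Eb p) (lockedState p.1 t dB (U p) x) - w p| := by
          rw [← Finset.mul_sum, Finset.sum_comm]
      _ ≤ 1 / P.card * ∑ p : P, ε / 2 * 2 ^ n * w p := by
          gcongr with p
          exact hp1 p
      _ = ε / 2 * ((2 ^ n : ℕ) : ℝ) * W := by
          rw [← Finset.mul_sum, hWdef]; push_cast; ring
  have havg : avgOutcomeProb (fingerprint (n := n) P t dB U) E = 1 / 2 ^ n * ∑ x, r x := by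
    rw [avgOutcomeProb, Finset.mul_sum]; rfl
  have hR : ∑ x, r x ≠ 0 := by
    intro h
    rw [havg, h, mul_zero] at hne
    exact hne rfl
  have hfin := half_sum_abs_normalize_sub_le hε0 hε hW hdev hR
  refine le_of_eq_of_le ?_ hfin
  rw [traceDist]
  congr 1
  refine Finset.sum_congr rfl fun x _ => ?_
  have : posterior (fingerprint (n := n) P t dB U) E x = r x / ∑ y, r y := by
    rw [posterior, havg, unifBits]
    exact mul_div_mul_left _ _ (by positivity)
  rw [this, unifBits]
  push_cast
  rfl

end Hiding

/-! ### Support projections -/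

section Support

variable {ι : Type} [Fintype ι] [DecidableEq ι] {H : Matrix ι ι ℂ}

/-- The function `f` of a Hermitian matrix. -/
def spectralMap (hH : H.IsHermitian) (f : ℝ → ℝ) : Matrix ι ι ℂ :=
  (hH.eigenvectorUnitary : Matrix ι ι ℂ) *
    Matrix.diagonal (fun i => (f (hH.eigenvalues i) : ℂ)) *
    (hH.eigenvectorUnitary : Matrix ι ι ℂ)ᴴ

lemma spectralMap_mul (hH : H.IsHermitian) (f g : ℝ → ℝ) :
    spectralMap hH f * spectralMap hH g = spectralMap hH (fun x => f x * g x) := by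
  have h : (hH.eigenvectorUnitary : Matrix ι ι ℂ)ᴴ * (hH.eigenvectorUnitary : Matrix ι ι ℂ) = 1 := by
    rw [← Matrix.star_eq_conjTranspose]; exact Unitary.coe_star_mul_self _
  have hd : Matrix.diagonal (fun i => ((f (hH.eigenvalues i) * g (hH.eigenvalues i) : ℝ) : ℂ)) =
      Matrix.diagonal (fun i => (f (hH.eigenvalues i) : ℂ)) *
      Matrix.diagonal (fun i => (g (hH.eigenvalues i) : ℂ)) := by
    rw [Matrix.diagonal_mul_diagonal]; simp
  simp only [spectralMap, hd]
  set V := (hH.eigenvectorUnitary : Matrix ι ι ℂ)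
  calc V * Matrix.diagonal (fun i => (f (hH.eigenvalues i) : ℂ)) * Vᴴ *
        (V * Matrix.diagonal (fun i => (g (hH.eigenvalues i) : ℂ)) * Vᴴ)
      = V * Matrix.diagonal (fun i => (f (hH.eigenvalues i) : ℂ)) * (Vᴴ * V) *
        (Matrix.diagonal (fun i => (g (hH.eigenvalues i) : ℂ)) * Vᴴ) := by
        simp only [Matrix.mul_assoc]
    _ = _ := by rw [h, Matrix.mul_one]; simp only [Matrix.mul_assoc]

lemma spectralMap_id (hH : H.IsHermitian) : spectralMap hH (fun x => x) = H :=
  (IsHermitian_eq_conj_diagonal hH).symm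

lemma spectralMap_one (hH : H.IsHermitian) : spectralMap hH (fun _ => 1) = 1 := by
  have h : (hH.eigenvectorUnitary : Matrix ι ι ℂ) * (hH.eigenvectorUnitary : Matrix ι ι ℂ)ᴴ = 1 := by
    rw [← Matrix.star_eq_conjTranspose]; exact Unitary.coe_mul_star_self _
  simp [spectralMap, h]

lemma spectralMap_sub (hH : H.IsHermitian) (f g : ℝ → ℝ) :
    spectralMap hH f - spectralMap hH g = spectralMap hH (fun x => f x - g x) := by
  have hd : Matrix.diagonal (fun i => ((f (hH.eigenvalues i) - g (hH.eigenvalues i) : ℝ) : ℂ)) =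
      Matrix.diagonal (fun i => (f (hH.eigenvalues i) : ℂ)) -
      Matrix.diagonal (fun i => (g (hH.eigenvalues i) : ℂ)) := by
    rw [Matrix.diagonal_sub]; simp
  simp only [spectralMap, hd, Matrix.mul_sub, Matrix.sub_mul]

lemma spectralMap_pow (hH : H.IsHermitian) (f : ℝ → ℝ) (m : ℕ) :
    spectralMap hH f ^ m = spectralMap hH (fun x => f x ^ m) := by
  induction m with
  | zero => simp [spectralMap_one]
  | succ m ih => simp only [pow_succ, ih, spectralMap_mul]

lemma spectralMap_posSemidef (hH : H.IsHermitian) {f : ℝ → ℝ}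
    (hf : ∀ i, 0 ≤ f (hH.eigenvalues i)) : (spectralMap hH f).PosSemidef := by
  have := posSemidef_conj_diagonal ((hH.eigenvectorUnitary : Matrix ι ι ℂ)ᴴ) hf
  rwa [Matrix.conjTranspose_conjTranspose] at this

lemma outcomeProb_spectralMap (hH : H.IsHermitian) (f : ℝ → ℝ) (K : Matrix ι ι ℂ) :
    outcomeProb (spectralMap hH f) K = ∑ i, f (hH.eigenvalues i) *
      (((hH.eigenvectorUnitary : Matrix ι ι ℂ)ᴴ * K *
        (hH.eigenvectorUnitary : Matrix ι ι ℂ)) i i).re := by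
  have h : ∀ V G : Matrix ι ι ℂ, (V * G * Vᴴ * K).trace = (G * (Vᴴ * K * V)).trace := fun V G => by
    rw [Matrix.mul_assoc (V * G), Matrix.mul_assoc V, Matrix.trace_mul_comm V]
    simp only [Matrix.mul_assoc]
  rw [outcomeProb, spectralMap, h, Matrix.trace, Complex.re_sum]
  refine Finset.sum_congr rfl fun i _ => ?_
  rw [Matrix.diag_apply, Matrix.diagonal_mul, Complex.re_ofReal_mul]

open Classical in
/-- The projection onto the support of a Hermitian matrix. -/
def supportProj (H : Matrix ι ι ℂ) : Matrix ι ι ℂ :=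
  if hH : H.IsHermitian then spectralMap hH fun x => if x = 0 then 0 else 1 else 0

lemma supportProj_eq (hH : H.IsHermitian) :
    supportProj H = spectralMap hH fun x => if x = 0 then 0 else 1 := by
  rw [supportProj, dif_pos hH]

lemma supportProj_posSemidef (hH : H.IsHermitian) : (supportProj H).PosSemidef := by
  rw [supportProj_eq hH]
  exact spectralMap_posSemidef hH fun i => by split_ifs <;> norm_num

lemma one_sub_supportProj_posSemidef (hH : H.IsHermitian) : (1 - supportProj H).PosSemidef := by
  rw [supportProj_eq hH, ← spectralMap_one hH, spectralMap_sub]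
  exact spectralMap_posSemidef hH fun i => by split_ifs <;> norm_num

lemma outcomeProb_supportProj_self (hH : H.IsHermitian) :
    outcomeProb (supportProj H) H = H.trace.re := by
  have : supportProj H * H = H := by
    calc supportProj H * H = supportProj H * spectralMap hH (fun x => x) := by rw [spectralMap_id]
      _ = spectralMap hH (fun x => x) := by
        rw [supportProj_eq hH, spectralMap_mul]
        congr 1
        ext x
        split_ifs with h <;> simp [h]
      _ = H := spectralMap_id hH
  rw [outcomeProb, this]

lemma trace_supportProj (hH : H.IsHermitian) : (supportProj H).trace.re = H.rank := by
  have h : (hH.eigenvectorUnitary : Matrix ι ι ℂ)ᴴ * (hH.eigenvectorUnitary : Matrix ι ι ℂ) = 1 := by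
    rw [← Matrix.star_eq_conjTranspose]; exact Unitary.coe_star_mul_self _
  rw [← outcomeProb_one, supportProj_eq hH, outcomeProb_spectralMap, Matrix.mul_one, h,
    hH.rank_eq_card_non_zero_eigs, Fintype.card_subtype, Finset.card_filter]
  push_cast
  refine Finset.sum_congr rfl fun i _ => ?_
  by_cases hi : hH.eigenvalues i = 0 <;> simp [hi]

/-- The eigenvalues lie in `[0, 1]`, and `1 - (1 - x) ^ m` tends there to the indicator of `x ≠ 0`.
-/
lemma tendsto_outcomeProb_supportProj (hH : H.PosSemidef) (htr : H.trace = 1) (K : Matrix ι ι ℂ) :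
    Filter.Tendsto (fun m : ℕ => outcomeProb (1 - (1 - H) ^ m) K) Filter.atTop
      (nhds (outcomeProb (supportProj H) K)) := by
  have h1 : ∀ m : ℕ, 1 - (1 - H) ^ m = spectralMap hH.1 (fun x => 1 - (1 - x) ^ m) := by
    intro m
    have : 1 - H = spectralMap hH.1 (fun x => 1 - x) := by
      rw [← spectralMap_sub hH.1 (fun _ => 1) (fun x => x), spectralMap_one, spectralMap_id]
    rw [this, spectralMap_pow, ← spectralMap_sub hH.1 (fun _ => 1), spectralMap_one]
  simp only [h1, supportProj_eq hH.1, outcomeProb_spectralMap]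
  refine tendsto_finsetSum _ fun i _ => Filter.Tendsto.mul_const _ ?_
  have h0 : 0 ≤ hH.1.eigenvalues i := hH.eigenvalues_nonneg i
  have hle : hH.1.eigenvalues i ≤ 1 := by
    have hs := hH.1.trace_eq_sum_eigenvalues
    rw [htr] at hs
    have hs' : (1 : ℝ) = ∑ j, hH.1.eigenvalues j := by
      apply Complex.ofReal_injective
      simpa using hs
    rw [hs']
    exact Finset.single_le_sum (f := hH.1.eigenvalues) (fun j _ => hH.eigenvalues_nonneg j)
      (Finset.mem_univ i)
  by_cases hi : hH.1.eigenvalues i = 0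
  · simp [hi]
  · have hpos : 0 < hH.1.eigenvalues i := lt_of_le_of_ne h0 (Ne.symm hi)
    have := tendsto_pow_atTop_nhds_zero_of_lt_one (r := 1 - hH.1.eigenvalues i) (by linarith)
      (by linarith)
    simpa [hi] using this.const_sub 1

end Support

/-! ### Block diagonal matrices -/

section Block

variable {P : Finset ℕ} {dB : ℕ}

/-- Blockwise square roots exhibit the matrix as `Cᴴ * C`. -/
lemma blockDiagonal'_posSemidef {M : (p : P) → Matrix (BasisAB p.1 dB) (BasisAB p.1 dB) ℂ}
    (hM : ∀ p, (M p).PosSemidef) :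
    (Matrix.blockDiagonal' M : Matrix (BasisC P dB) (BasisC P dB) ℂ).PosSemidef := by
  let C : (p : P) → Matrix (BasisAB p.1 dB) (BasisAB p.1 dB) ℂ :=
    fun p => spectralMap (hM p).1 Real.sqrt
  have hC : ∀ p, (C p)ᴴ * C p = M p := fun p => by
    have h1 : (C p).PosSemidef := spectralMap_posSemidef _ fun i => Real.sqrt_nonneg _
    rw [h1.1.eq]
    simp only [C]
    rw [spectralMap_mul]
    conv_rhs => rw [← spectralMap_id (hM p).1]
    simp only [spectralMap]
    congr 3
    ext i
    rw [Real.mul_self_sqrt ((hM p).eigenvalues_nonneg i)]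
  have : (Matrix.blockDiagonal' M : Matrix (BasisC P dB) (BasisC P dB) ℂ) =
      (Matrix.blockDiagonal' C)ᴴ * Matrix.blockDiagonal' C := by
    rw [Matrix.blockDiagonal'_conjTranspose, ← Matrix.blockDiagonal'_mul]
    simp only [hC]
  rw [this]
  exact Matrix.posSemidef_conjTranspose_mul_self _

lemma primeBlock_blockDiagonal' (M : (p : P) → Matrix (BasisAB p.1 dB) (BasisAB p.1 dB) ℂ)
    (p : P) : primeBlock (Matrix.blockDiagonal' M) p = M p := by
  ext i j
  rw [primeBlock, Matrix.submatrix_apply, Matrix.blockDiagonal'_apply_eq]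

end Block

/-! ### The overlap of different locked states -/

section Overlap

variable {p t dB : ℕ}

/-- The probability that the support test for `y` accepts the locked state of `x`. -/
def overlap (p t dB y x : ℕ) (U : Fin t → Matrix.unitaryGroup (BasisAB p dB) ℂ) : ℝ :=
  outcomeProb (supportProj (lockedState p t dB U y)) (lockedState p t dB U x)

lemma overlap_nonneg (y x : ℕ) (U : Fin t → Matrix.unitaryGroup (BasisAB p dB) ℂ) :
    0 ≤ overlap p t dB y x U :=
  outcomeProb_nonneg (supportProj_posSemidef (lockedState_posSemidef U y).1) (lockedState_posSemidef U x)

lemma overlap_le_one (hp : 0 < p) (ht : 0 < t) (hdB : 0 < dB) (y x : ℕ)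
    (U : Fin t → Matrix.unitaryGroup (BasisAB p dB) ℂ) : overlap p t dB y x U ≤ 1 := by
  have h := outcomeProb_nonneg (one_sub_supportProj_posSemidef (lockedState_posSemidef U y).1)
    (lockedState_posSemidef U x)
  rw [outcomeProb, Matrix.sub_mul, Matrix.one_mul, Matrix.trace_sub, trace_lockedState hp ht hdB,
    Complex.sub_re, Complex.one_re] at h
  rw [overlap, outcomeProb]
  linarith

lemma overlap_self (hp : 0 < p) (ht : 0 < t) (hdB : 0 < dB) (x : ℕ)
    (U : Fin t → Matrix.unitaryGroup (BasisAB p dB) ℂ) : overlap p t dB x x U = 1 := by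
  rw [overlap, outcomeProb_supportProj_self (lockedState_posSemidef U x).1, trace_lockedState hp ht hdB, Complex.one_re]

/-- A support projection may jump where the rank drops, so continuity is unavailable; the overlap is
instead a pointwise limit of polynomials in the locked states. -/
lemma measurable_overlap (hp : 0 < p) (ht : 0 < t) (hdB : 0 < dB) (y x : ℕ) :
    Measurable (overlap p t dB y x) := by
  refine measurable_of_tendsto_metrizable (f := fun (m : ℕ)
    (U : Fin t → Matrix.unitaryGroup (BasisAB p dB) ℂ) =>
    outcomeProb (1 - (1 - lockedState p t dB U y) ^ m) (lockedState p t dB U x)) ?_ ?_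
  · intro m
    apply Continuous.measurable
    have h1 := continuous_lockedState (p := p) (t := t) (dB := dB) y
    have h2 := continuous_lockedState (p := p) (t := t) (dB := dB) x
    exact Complex.continuous_re.comp
      ((((continuous_const.sub ((continuous_const.sub h1).pow m))).matrix_mul h2).matrix_trace)
  · rw [tendsto_pi_nhds]
    intro U
    exact tendsto_outcomeProb_supportProj (lockedState_posSemidef U y)
      (trace_lockedState hp ht hdB U y) _

/-- The state is a multiple of `Bᴴ * B`, where `B` collects the `t dB` rows `(a, b)` of the
unitaries. -/
lemma rank_lockedState_le (hp : 0 < p) (U : Fin t → Matrix.unitaryGroup (BasisAB p dB) ℂ) (x : ℕ) :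
    (lockedState p t dB U x).rank ≤ t * dB := by
  let a : Fin p := ⟨x % p, Nat.mod_lt x hp⟩
  let B : Matrix (Fin t × Fin dB) (BasisAB p dB) ℂ :=
    Matrix.of fun kb i => (U kb.1 : Matrix (BasisAB p dB) (BasisAB p dB) ℂ) (a, kb.2) i
  have h : lockedState p t dB U x = ((((1 / dB : ℝ) : ℂ) * (1 / (t : ℂ))) • Bᴴ) * B := by
    rw [lockedState_eq, avgConj_apply, smul_smul, Matrix.smul_mul]
    congr 1
    ext i j
    rw [Matrix.sum_apply, Matrix.mul_apply, Fintype.sum_prod_type]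
    refine Finset.sum_congr rfl fun k _ => ?_
    rw [Matrix.mul_apply, Fintype.sum_prod_type, Finset.sum_eq_single a]
    · refine Finset.sum_congr rfl fun b _ => ?_
      rw [Matrix.mul_diagonal]
      simp [B, a, labelIndicator]
    · intro a' _ ha'
      have : a'.val ≠ x % p := fun h => ha' (Fin.ext h)
      refine Finset.sum_eq_zero fun b _ => ?_
      rw [Matrix.mul_diagonal]
      simp [labelIndicator, this]
    · simp
  rw [h]
  refine (Matrix.rank_mul_le_right _ _).trans ((Matrix.rank_le_card_height B).trans ?_)
  simp

/-- The unitary that permutes the labels of `A`. -/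
def labelPerm (dB : ℕ) (σ : Equiv.Perm (Fin p)) : Matrix.unitaryGroup (BasisAB p dB) ℂ :=
  ⟨(1 : Matrix (BasisAB p dB) (BasisAB p dB) ℂ).submatrix (σ.prodCongr (Equiv.refl _)) id, by
    rw [Matrix.mem_unitaryGroup_iff, Matrix.star_eq_conjTranspose, Matrix.conjTranspose_submatrix,
      Matrix.conjTranspose_one, ← Matrix.submatrix_mul _ _ _ id _ Function.bijective_id,
      Matrix.mul_one, Matrix.submatrix_one _ (Equiv.injective _)]⟩

lemma labelPerm_mul_apply (σ : Equiv.Perm (Fin p))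
    (M : Matrix (BasisAB p dB) (BasisAB p dB) ℂ) (i j : BasisAB p dB) :
    ((labelPerm dB σ : Matrix (BasisAB p dB) (BasisAB p dB) ℂ) * M) i j = M (σ i.1, i.2) j := by
  rw [labelPerm, Matrix.mul_apply]
  simp [Matrix.one_apply]
  rfl

lemma lockedState_labelPerm (σ : Equiv.Perm (Fin p)) (a : Fin p)
    (U : Fin t → Matrix.unitaryGroup (BasisAB p dB) ℂ) :
    lockedState p t dB ((fun _ => labelPerm dB σ) * U) a = lockedState p t dB U (σ a) := by
  rw [lockedState_eq, lockedState_eq, Nat.mod_eq_of_lt a.2, Nat.mod_eq_of_lt (σ a).2,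
    avgConj_apply, avgConj_apply]
  congr 3
  ext k i j
  rw [Matrix.mul_apply, Matrix.mul_apply]
  simp only [Matrix.mul_diagonal, Pi.mul_apply, Submonoid.coe_mul, Matrix.conjTranspose_apply,
    labelPerm_mul_apply]
  rw [← Equiv.sum_comp (σ.prodCongr (Equiv.refl (Fin dB))) (fun l => star
    ((U k : Matrix (BasisAB p dB) (BasisAB p dB) ℂ) l i) * (labelIndicator p dB (σ a) l : ℂ) *
      (U k : Matrix (BasisAB p dB) (BasisAB p dB) ℂ) l j)]
  refine Finset.sum_congr rfl fun l _ => ?_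
  have : labelIndicator p dB (σ a) ((σ.prodCongr (Equiv.refl (Fin dB))) l) =
      labelIndicator p dB a l := by
    simp [labelIndicator, ← Fin.ext_iff]
  rw [this]
  rfl

/-- The locked states of all labels sum to `1 / dB` times the identity, so the left side is the rank
of one of them divided by `dB`. -/
lemma sum_overlap_le (hp : 0 < p) (ht : 0 < t) (hdB : 0 < dB) (b : ℕ)
    (U : Fin t → Matrix.unitaryGroup (BasisAB p dB) ℂ) :
    ∑ a : Fin p, overlap p t dB b a U ≤ t := by
  have hd' : (0 : ℝ) < dB := by exact_mod_cast hdB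
  have h : ∑ a : Fin p, overlap p t dB b a U = (1 / dB) *
      (supportProj (lockedState p t dB U b)).trace.re := by
    rw [← outcomeProb_one, ← avgConj_one ht U, ← sum_labelIndicator, map_sum,
      ← outcomeProbLM_apply, map_sum, Finset.mul_sum]
    refine Finset.sum_congr rfl fun a _ => ?_
    rw [overlap, lockedState_eq U a, outcomeProb_ofReal_smul, Nat.mod_eq_of_lt a.2]
    rfl
  rw [h, trace_supportProj (lockedState_posSemidef U b).1, one_div, inv_mul_le_iff₀ hd', mul_comm]
  exact_mod_cast rank_lockedState_le hp U b

lemma integrable_overlap (hp : 0 < p) (ht : 0 < t) (hdB : 0 < dB) (y x : ℕ) :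
    Integrable (overlap p t dB y x) (Measure.pi fun _ : Fin t => haarUnitary (BasisAB p dB)) := by
  refine Integrable.of_bound (measurable_overlap hp ht hdB y x).aestronglyMeasurable 1
    (Filter.Eventually.of_forall fun U => ?_)
  rw [Real.norm_eq_abs, abs_of_nonneg (overlap_nonneg y x U)]
  exact overlap_le_one hp ht hdB y x U

instance piHaar_isMulLeftInvariant {ι : Type} [Fintype ι] [DecidableEq ι] (t : ℕ) :
    (Measure.pi fun _ : Fin t => haarUnitary ι).IsMulLeftInvariant :=
  Measure.pi.isMulLeftInvariant _

lemma overlap_labelPerm (σ : Equiv.Perm (Fin p)) (a b : Fin p)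
    (U : Fin t → Matrix.unitaryGroup (BasisAB p dB) ℂ) :
    overlap p t dB b a ((fun _ => labelPerm dB σ) * U) = overlap p t dB (σ b) (σ a) U := by
  rw [overlap, overlap, lockedState_labelPerm, lockedState_labelPerm]

/-- Left multiplication of every unitary by the transposition of `a` and `c` preserves the law and
fixes the label `b`. -/
lemma integral_overlap_swap {a b c : Fin p} (hab : a ≠ b) (hcb : c ≠ b) :
    ∫ U, overlap p t dB b c U ∂(Measure.pi fun _ : Fin t => haarUnitary (BasisAB p dB)) =
      ∫ U, overlap p t dB b a U ∂(Measure.pi fun _ : Fin t => haarUnitary (BasisAB p dB)) := by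
  have h := integral_mul_left_eq_self
    (μ := Measure.pi fun _ : Fin t => haarUnitary (BasisAB p dB)) (overlap p t dB b a)
    (fun _ => labelPerm dB (Equiv.swap a c))
  rw [← h]
  refine integral_congr_ae (Filter.Eventually.of_forall fun U => ?_)
  simp only [overlap_labelPerm]
  rw [Equiv.swap_apply_left, Equiv.swap_apply_of_ne_of_ne hab.symm hcb.symm]

lemma integral_overlap_le (hp : 1 < p) (ht : 0 < t) (hdB : 0 < dB) {y x : ℕ}
    (hxy : x % p ≠ y % p) :
    ∫ U, overlap p t dB y x U ∂(Measure.pi fun _ : Fin t => haarUnitary (BasisAB p dB)) ≤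
      t / (p - 1) := by
  have hp0 : 0 < p := by omega
  set ν := Measure.pi fun _ : Fin t => haarUnitary (BasisAB p dB) with hν
  let a : Fin p := ⟨x % p, Nat.mod_lt x hp0⟩
  let b : Fin p := ⟨y % p, Nat.mod_lt y hp0⟩
  have hab : a ≠ b := fun h => hxy (congrArg Fin.val h)
  have hyb : ∀ (U : Fin t → Matrix.unitaryGroup (BasisAB p dB) ℂ) (z : ℕ),
      overlap p t dB y z U = overlap p t dB b z U := by
    intro U z
    simp only [overlap, b, lockedState_mod U y]
  have hxa : ∀ (U : Fin t → Matrix.unitaryGroup (BasisAB p dB) ℂ) (z : ℕ),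
      overlap p t dB z x U = overlap p t dB z a U := by
    intro U z
    simp only [overlap, a, lockedState_mod U x]
  simp only [hxa, hyb]
  have hsym : ∀ c : Fin p, c ≠ b →
      ∫ U, overlap p t dB b c U ∂ν = ∫ U, overlap p t dB b a U ∂ν := by
    exact fun c hc => integral_overlap_swap hab hc
  have hsum : ∑ c : Fin p, ∫ U, overlap p t dB b c U ∂ν ≤ t := by
    rw [← integral_finsetSum Finset.univ (f := fun (c : Fin p) U => overlap p t dB b c U)
      fun c _ => integrable_overlap hp0 ht hdB b c]
    calc ∫ U, ∑ c : Fin p, overlap p t dB b c U ∂ν ≤ ∫ _U, (t : ℝ) ∂ν :=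
          integral_mono (integrable_finsetSum Finset.univ fun (c : Fin p) _ => integrable_overlap hp0 ht hdB b c)
            (integrable_const _) fun U => sum_overlap_le hp0 ht hdB b U
      _ = t := by simp
  have hp1 : (0 : ℝ) < p - 1 := by
    have : (1 : ℝ) < p := by exact_mod_cast hp
    linarith
  rw [le_div_iff₀ hp1]
  rw [← Finset.add_sum_erase _ _ (Finset.mem_univ b),
    Finset.sum_congr rfl fun c hc => hsym c (Finset.ne_of_mem_erase hc), Finset.sum_const,
    Finset.card_erase_of_mem (Finset.mem_univ b), Finset.card_univ, Fintype.card_fin,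
    nsmul_eq_mul, Nat.cast_sub hp.le, Nat.cast_one] at hsum
  have : 0 ≤ ∫ U, overlap p t dB b b U ∂ν := integral_nonneg fun U => overlap_nonneg _ _ U
  linarith

end Overlap

/-! ### A Chernoff bound -/

section Chernoff

/-- A Chernoff bound for sums of independent variables in `[0, 1]` with small means. -/
lemma measure_sum_ge_le {κ : Type} [Fintype κ] {Ω : κ → Type} [∀ i, MeasurableSpace (Ω i)]
    (μ : ∀ i, Measure (Ω i)) [∀ i, IsProbabilityMeasure (μ i)] {X : ∀ i, Ω i → ℝ}
    (hX : ∀ i, Measurable (X i)) (h0 : ∀ i ω, 0 ≤ X i ω) (h1 : ∀ i ω, X i ω ≤ 1)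
    {m lam : ℝ} (hm : ∀ i, ∫ ω, X i ω ∂μ i ≤ m) (hlam : 0 ≤ lam) (θ : ℝ) :
    (Measure.pi μ).real {ω | θ ≤ ∑ i, X i (ω i)} ≤
      Real.exp (-(lam * θ) + Fintype.card κ * (Real.exp lam * m)) := by
  have hexp : ∀ ω : ∀ i, Ω i, Real.exp (lam * ∑ i, X i (ω i)) =
      ∏ i, Real.exp (lam * X i (ω i)) := by
    intro ω; rw [Finset.mul_sum, Real.exp_sum]
  have hXint : ∀ i, Integrable (X i) (μ i) := fun i =>
    Integrable.of_bound (hX i).aestronglyMeasurable 1 (Filter.Eventually.of_forall fun ω => by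
      rw [Real.norm_eq_abs, abs_of_nonneg (h0 i ω)]; exact h1 i ω)
  have hint1 : ∀ i, Integrable (fun ω => Real.exp (lam * X i ω)) (μ i) := fun i =>
    Integrable.of_bound (by have := hX i; fun_prop) (Real.exp lam)
      (Filter.Eventually.of_forall fun ω => by
        rw [Real.norm_eq_abs, Real.abs_exp, Real.exp_le_exp]
        nlinarith [h1 i ω])
  have hint : Integrable (fun ω : ∀ i, Ω i => Real.exp (lam * ∑ i, X i (ω i))) (Measure.pi μ) := by
    simp only [hexp]
    exact Integrable.fintype_prod_dep hint1
  have hE : ∀ i, ∫ ω, Real.exp (lam * X i ω) ∂μ i ≤ Real.exp (Real.exp lam * m) := by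
    intro i
    -- On `[0, 1]` the exponential lies below its chord; the term `-X` is dropped.
    have hc : ∀ ω, Real.exp (lam * X i ω) ≤ 1 + Real.exp lam * X i ω := by
      intro ω
      have h := convexOn_exp.2 (Set.mem_univ (0 : ℝ)) (Set.mem_univ lam)
        (sub_nonneg.2 (h1 i ω)) (h0 i ω) (by ring)
      simp only [smul_eq_mul, mul_zero, zero_add, Real.exp_zero, mul_one] at h
      rw [mul_comm (X i ω) lam] at h
      have := h0 i ω
      linarith
    calc ∫ ω, Real.exp (lam * X i ω) ∂μ i ≤ ∫ ω, (1 + Real.exp lam * X i ω) ∂μ i :=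
          integral_mono (hint1 i) ((integrable_const _).add ((hXint i).const_mul _)) hc
      _ = 1 + Real.exp lam * ∫ ω, X i ω ∂μ i := by
          rw [integral_add (integrable_const _) ((hXint i).const_mul _), integral_const_mul]
          simp
      _ ≤ 1 + Real.exp lam * m := by
          have := mul_le_mul_of_nonneg_left (hm i) (Real.exp_pos lam).le
          linarith
      _ ≤ Real.exp (Real.exp lam * m) := by
          have := Real.add_one_le_exp (Real.exp lam * m)
          linarith
  refine (measure_ge_le_exp_mul_mgf θ hlam hint).trans ?_
  have hmgf : mgf (fun ω : ∀ i, Ω i => ∑ i, X i (ω i)) (Measure.pi μ) lam ≤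
      Real.exp (Fintype.card κ * (Real.exp lam * m)) := by
    rw [mgf]
    simp only [hexp]
    rw [integral_fintype_prod_eq_prod (f := fun i ω => Real.exp (lam * X i ω)), Real.exp_nat_mul]
    calc ∏ i, ∫ ω, Real.exp (lam * X i ω) ∂μ i ≤ ∏ _i : κ, Real.exp (Real.exp lam * m) :=
          Finset.prod_le_prod (fun i _ => integral_nonneg fun ω => (Real.exp_pos _).le)
            fun i _ => hE i
      _ = _ := by simp
  refine (mul_le_mul_of_nonneg_left hmgf (Real.exp_pos _).le).trans (le_of_eq ?_)
  rw [← Real.exp_add]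
  congr 1
  ring

end Chernoff

/-! ### Counting primes -/

section Primes

/-- The primes in `(n, 2 n]` account for a large part of the central binomial coefficient. -/
lemma centralBinom_le_pow_card_primes (n : ℕ) (hn : 2 < n) :
    n.centralBinom ≤ (2 * n) ^ Nat.sqrt (2 * n) * 4 ^ (2 * n / 3) *
      (2 * n) ^ ((Finset.range (2 * n + 1)).filter fun p => p.Prime ∧ n < p).card := by
  have hn0 : 0 < n := by omega
  have hn1 : 1 ≤ 2 * n := by omega
  let f : ℕ → ℕ := fun x => x ^ n.centralBinom.factorization x
  have hf1 : ∀ x, ¬ x.Prime → f x = 1 := fun x hx => by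
    simp only [f, Nat.factorization_eq_zero_of_not_prime _ hx, pow_zero]
  have hf2 : ∀ x, f x ≤ 2 * n := fun x => Nat.pow_factorization_choose_le (by omega)
  have hsplit : n.centralBinom = (∏ x ∈ Finset.range (2 * n / 3 + 1), f x) *
      ∏ x ∈ Finset.Ico (2 * n / 3 + 1) (2 * n + 1), f x := by
    rw [Finset.prod_range_mul_prod_Ico f (by omega)]
    exact (Nat.prod_pow_factorization_centralBinom n).symm
  rw [hsplit]
  refine Nat.mul_le_mul ?_ ?_
  · let S := (Finset.range (2 * n / 3 + 1)).filter Nat.Prime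
    have hS : ∏ x ∈ S, f x = ∏ x ∈ Finset.range (2 * n / 3 + 1), f x := by
      refine Finset.prod_filter_of_ne fun p _ h => ?_
      by_contra hp
      exact h (hf1 p hp)
    -- Each prime up to `√(2n)` contributes a power of at most `2 n`. The larger ones occur with
    -- exponent at most one, so the primorial bound covers them.
    rw [← hS, ← Finset.prod_filter_mul_prod_filter_not S (· ≤ Nat.sqrt (2 * n))]
    refine Nat.mul_le_mul ?_ ?_
    · refine (Finset.prod_le_prod' fun p _ => hf2 p).trans ?_
      rw [Finset.prod_const]
      have : (Finset.Icc 1 (Nat.sqrt (2 * n))).card = Nat.sqrt (2 * n) := by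
        rw [Nat.card_Icc, Nat.add_sub_cancel]
      refine pow_right_mono₀ hn1 ((Finset.card_le_card fun x hx => ?_).trans this.le)
      obtain ⟨h1, h2⟩ := Finset.mem_filter.1 hx
      exact Finset.mem_Icc.mpr ⟨(Finset.mem_filter.1 h1).2.one_lt.le, h2⟩
    · refine le_trans ?_ (primorial_le_four_pow (2 * n / 3))
      refine (Finset.prod_le_prod' fun p hp => (?_ : f p ≤ p)).trans ?_
      · obtain ⟨h1, h2⟩ := Finset.mem_filter.1 hp
        refine (pow_right_mono₀ (Finset.mem_filter.1 h1).2.one_lt.le ?_).trans (pow_one p).le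
        exact Nat.factorization_choose_le_one (Nat.sqrt_lt'.mp <| not_le.1 h2)
      refine Finset.prod_le_prod_of_subset_of_one_le' (Finset.filter_subset _ _) ?_
      exact fun p hp _ => (Finset.mem_filter.1 hp).2.one_lt.le
  -- Primes in `(2n / 3, n]` do not divide the central binomial coefficient, so only those above `n`
  -- remain.
  · calc ∏ x ∈ Finset.Ico (2 * n / 3 + 1) (2 * n + 1), f x
        ≤ ∏ x ∈ Finset.Ico (2 * n / 3 + 1) (2 * n + 1), if x.Prime ∧ n < x then 2 * n else 1 := by
          refine Finset.prod_le_prod' fun x hx => ?_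
          split_ifs with h
          · exact hf2 x
          · by_cases hp : x.Prime
            · have hxn : x ≤ n := by
                by_contra hcon
                exact h ⟨hp, by omega⟩
              have hx3 : 2 * n < 3 * x := by
                have := (Finset.mem_Ico.1 hx).1
                omega
              simp only [f, Nat.factorization_centralBinom_of_two_mul_self_lt_three_mul hn hxn hx3,
                pow_zero, le_refl]
            · exact (hf1 x hp).le
      _ ≤ (2 * n) ^ ((Finset.range (2 * n + 1)).filter fun p => p.Prime ∧ n < p).card := by
          rw [Finset.prod_ite, Finset.prod_const, Finset.prod_const_one, mul_one]
          refine pow_right_mono₀ hn1 (Finset.card_le_card fun x hx => ?_)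
          obtain ⟨h1, h2⟩ := Finset.mem_filter.1 hx
          exact Finset.mem_filter.2 ⟨Finset.mem_range.2 (Finset.mem_Ico.1 h1).2, h2⟩

/-- Too few primes above `n` would make the central binomial coefficient smaller than `4 ^ n / n`.
With `x = 2 n`, taking logarithms would give `(x / 6) log 4 ≤ (2 + 2 √x) log x`, false for large
`x`. -/
lemma sqrt_lt_card_primes {n : ℕ} (hn : 4000000 ≤ n) :
    √(2 * n) + 1 < ((Finset.range (2 * n + 1)).filter fun p => p.Prime ∧ n < p).card := by
  set k := ((Finset.range (2 * n + 1)).filter fun p => p.Prime ∧ n < p).card with hk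
  by_contra hcon
  rw [not_lt] at hcon
  have h1 := Nat.four_pow_lt_mul_centralBinom n (by omega)
  have h2 : 4 ^ n < n * ((2 * n) ^ Nat.sqrt (2 * n) * 4 ^ (2 * n / 3) * (2 * n) ^ k) :=
    h1.trans_le (Nat.mul_le_mul_left n (centralBinom_le_pow_card_primes n (by omega)))
  have hn' : (4000000 : ℝ) ≤ n := by exact_mod_cast hn
  set x : ℝ := 2 * n with hx
  have hx0 : 8000000 ≤ x := by linarith
  have h3 : (4 : ℝ) ^ n < n * (x ^ Nat.sqrt (2 * n) * 4 ^ (2 * n / 3) * x ^ k) := by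
    rw [hx]; exact_mod_cast h2
  have hlog := Real.log_lt_log (by positivity) h3
  have hxpos : 0 < x := by linarith
  have hnpos : (0 : ℝ) < n := by linarith
  rw [Real.log_mul hnpos.ne' (by positivity), Real.log_mul (by positivity) (by positivity),
    Real.log_mul (by positivity) (by positivity), Real.log_pow, Real.log_pow, Real.log_pow,
    Real.log_pow] at hlog
  have hlog4 : (1.38 : ℝ) ≤ Real.log 4 := by
    have : Real.log 4 = 2 * Real.log 2 := by
      rw [show (4 : ℝ) = 2 ^ 2 by norm_num, Real.log_pow]; norm_num
    rw [this]
    linarith [Real.log_two_gt_d9]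
  have hdiv : ((2 * n / 3 : ℕ) : ℝ) ≤ x / 3 := by
    have : ((2 * n / 3 : ℕ) : ℝ) ≤ ((2 * n : ℕ) : ℝ) / (3 : ℕ) := Nat.cast_div_le
    push_cast at this
    rw [hx]; linarith
  have hlogn : Real.log n ≤ Real.log x := Real.log_le_log hnpos (by linarith)
  have hlogx0 : 0 ≤ Real.log x := Real.log_nonneg (by linarith)
  have hs : ((Nat.sqrt (2 * n) : ℕ) : ℝ) ≤ √x := by
    have := Real.nat_sqrt_le_real_sqrt (a := 2 * n)
    rw [hx]; exact_mod_cast this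
  -- In terms of the fourth root, `log x ≤ 4 y` and the inequality becomes polynomial; it fails from
  -- `y = 50` on, and `50 ^ 4 < 8000000`.
  set y := √(√x) with hy
  have hy2 : y ^ 2 = √x := Real.sq_sqrt (Real.sqrt_nonneg x)
  have hy4 : y ^ 4 = x := by
    rw [show y ^ 4 = (y ^ 2) ^ 2 by ring, hy2, Real.sq_sqrt hxpos.le]
  have hy0 : 0 ≤ y := Real.sqrt_nonneg _
  have hy50 : 50 ≤ y := by
    by_contra hlt
    rw [not_le] at hlt
    have : y ^ 4 < 50 ^ 4 := by gcongr
    rw [hy4] at this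
    norm_num at this
    linarith
  have hlogx : Real.log x ≤ 4 * y := by
    have h5 : Real.log x = 4 * Real.log y := by
      rw [← hy4, Real.log_pow]; norm_num
    have := Real.log_le_sub_one_of_pos (show 0 < y by linarith)
    rw [h5]; linarith
  have hmain : x / 6 * Real.log 4 ≤ (2 + 2 * √x) * Real.log x := by
    have e1 : (n : ℝ) * Real.log 4 = x / 2 * Real.log 4 := by rw [hx]; ring
    have e2 : ((2 * n / 3 : ℕ) : ℝ) * Real.log 4 ≤ x / 3 * Real.log 4 :=
      mul_le_mul_of_nonneg_right hdiv (by linarith)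
    have e3 := mul_le_mul_of_nonneg_right hs hlogx0
    have e4 := mul_le_mul_of_nonneg_right hcon hlogx0
    rw [e1] at hlog
    linarith
  have h6 : x / 6 * 1.38 ≤ (2 + 2 * √x) * (4 * y) := by
    calc x / 6 * 1.38 ≤ x / 6 * Real.log 4 := by gcongr
      _ ≤ (2 + 2 * √x) * Real.log x := hmain
      _ ≤ (2 + 2 * √x) * (4 * y) := by gcongr
  rw [← hy2, ← hy4] at h6
  have h7 : y ^ 4 * 0.23 ≤ 8 * y + 8 * y ^ 3 := by linarith
  have h8 : 50 * y ^ 3 ≤ y ^ 4 := by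
    have : 0 ≤ y ^ 3 * (y - 50) := mul_nonneg (by positivity) (by linarith)
    linarith
  have h9 : 2500 * y ≤ y ^ 3 := by
    have : 0 ≤ y * (y ^ 2 - 2500) := mul_nonneg hy0 (by nlinarith)
    linarith
  nlinarith

/-- An interval `[l, l + m]` with `l ≤ m` contains at least `√m` primes. -/
lemma sqrt_le_card_primesBetween {l m : ℝ} (hl : 5000000 ≤ l) (hlm : l ≤ m) :
    √m ≤ (primesBetween l (l + m)).card := by
  set N := ⌊(l + m) / 2⌋₊ with hN
  -- Primes in `(N, 2N]` exceed the midpoint, which is at least `l` because `l ≤ m`, and they do not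
  -- exceed `l + m`.
  have hu : 0 ≤ (l + m) / 2 := by linarith
  have h1 : (N : ℝ) ≤ (l + m) / 2 := Nat.floor_le hu
  have h2 : (l + m) / 2 < N + 1 := Nat.lt_floor_add_one _
  have hN4 : 4000000 ≤ N := Nat.le_floor (by push_cast; linarith)
  have h3 := sqrt_lt_card_primes hN4
  have hsub : ((Finset.range (2 * N + 1)).filter fun p => p.Prime ∧ N < p) ⊆
      primesBetween l (l + m) := by
    intro p hp
    obtain ⟨hp1, hp2, hp3⟩ := Finset.mem_filter.1 hp
    have hp4 : p ≤ 2 * N := by have := Finset.mem_range.1 hp1; omega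
    have hp5 : (p : ℝ) ≤ 2 * N := by exact_mod_cast hp4
    have hp6 : (N : ℝ) + 1 ≤ p := by exact_mod_cast hp3
    refine Finset.mem_filter.2 ⟨Finset.mem_range.2 ?_, hp2, by linarith, by linarith⟩
    have : p ≤ ⌊l + m⌋₊ := Nat.le_floor (by linarith)
    omega
  have h4 : (((Finset.range (2 * N + 1)).filter fun p => p.Prime ∧ N < p).card : ℝ) ≤
      (primesBetween l (l + m)).card := by exact_mod_cast Finset.card_le_card hsub
  refine le_trans ?_ (h3.le.trans h4)
  rw [Real.sqrt_le_left (by positivity)]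
  have h5 : √(2 * (N : ℝ)) ^ 2 = 2 * N := Real.sq_sqrt (by positivity)
  have h6 : 1 ≤ √(2 * (N : ℝ)) := by
    rw [Real.one_le_sqrt]
    have : (4000000 : ℝ) ≤ N := by exact_mod_cast hN4
    linarith
  nlinarith

/-- Distinct `n`-bit numbers are congruent modulo few large primes. -/
lemma card_primes_mod_eq_le {n x y : ℕ} (hx : x < 2 ^ n) (hy : y < 2 ^ n) (hxy : x ≠ y)
    {B : Finset ℕ} (hB : ∀ p ∈ B, p.Prime ∧ 256 ≤ p ∧ x % p = y % p) : 8 * B.card ≤ n := by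
  wlog h : x < y generalizing x y
  · exact this hy hx hxy.symm (fun p hp => ⟨(hB p hp).1, (hB p hp).2.1, (hB p hp).2.2.symm⟩)
      (by omega)
  have hdvd : ∏ p ∈ B, p ∣ y - x := by
    refine Finset.prod_primes_dvd _ (fun p hp => (hB p hp).1.prime) fun p hp => ?_
    exact (Nat.modEq_iff_dvd' h.le).1 (hB p hp).2.2
  have h1 : 256 ^ B.card ≤ ∏ p ∈ B, p := Finset.pow_card_le_prod B _ _ fun p hp => (hB p hp).2.1
  have h2 := Nat.le_of_dvd (by omega) hdvd
  have h3 : 2 ^ (8 * B.card) < 2 ^ n := by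
    rw [pow_mul]; norm_num; omega
  exact ((Nat.pow_lt_pow_iff_right (by norm_num)).1 h3).le

end Primes

/-! ### The scheme succeeds with overwhelming probability -/

section Scheme

lemma fingerprint_isDensityOperator {n : ℕ} {P : Finset ℕ} {t dB : ℕ} (hP : ∀ p ∈ P, 0 < p)
    (hPne : P.Nonempty) (ht : 0 < t) (hdB : 0 < dB) (U : UnitaryFamily P t dB) (x : Fin (2 ^ n)) :
    IsDensityOperator (fingerprint P t dB U x) := by
  have hc : (P.card : ℂ) ≠ 0 := by exact_mod_cast hPne.card_pos.ne'
  constructor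
  · rw [fingerprint]
    refine (blockDiagonal'_posSemidef fun p => lockedState_posSemidef (U p) x).smul ?_
    rw [one_div]
    exact inv_nonneg.2 (Nat.cast_nonneg _)
  · rw [fingerprint, Matrix.trace_smul, Matrix.trace_blockDiagonal']
    simp only [fun p : P => trace_lockedState (hP p.1 p.2) ht hdB (U p) x]
    simp [hc]

/-- The measurement that tests for membership in the support of the fingerprint of `y`. -/
def supportTest {n : ℕ} (P : Finset ℕ) (t dB : ℕ) (U : UnitaryFamily P t dB) (y : Fin (2 ^ n)) :
    Matrix (BasisC P dB) (BasisC P dB) ℂ :=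
  Matrix.blockDiagonal' fun p : P => supportProj (lockedState p.1 t dB (U p) y)

lemma supportTest_isBinaryMeasurement {n : ℕ} {P : Finset ℕ} {t dB : ℕ} (U : UnitaryFamily P t dB)
    (y : Fin (2 ^ n)) : IsBinaryMeasurement (supportTest P t dB U y) := by
  constructor
  · exact blockDiagonal'_posSemidef fun p => supportProj_posSemidef (lockedState_posSemidef _ _).1
  · have : (1 : Matrix (BasisC P dB) (BasisC P dB) ℂ) - supportTest P t dB U y =
        Matrix.blockDiagonal' fun p : P => 1 - supportProj (lockedState p.1 t dB (U p) y) := by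
      rw [supportTest, ← Matrix.blockDiagonal'_one, ← Matrix.blockDiagonal'_sub]
      rfl
    rw [this]
    exact blockDiagonal'_posSemidef fun p =>
      one_sub_supportProj_posSemidef (lockedState_posSemidef _ _).1

lemma outcomeProb_supportTest {n : ℕ} {P : Finset ℕ} {t dB : ℕ} (U : UnitaryFamily P t dB)
    (y x : Fin (2 ^ n)) : outcomeProb (supportTest P t dB U y) (fingerprint P t dB U x) =
      1 / P.card * ∑ p : P, overlap p.1 t dB y x (U p) := by
  rw [outcomeProb_fingerprint]
  simp only [supportTest, primeBlock_blockDiagonal', overlap]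

/-- The acceptance probability of the test for `y` on the locked state of `x`, counted only for the
primes that distinguish `x` from `y`. -/
def cleanOverlap (p t dB y x : ℕ) (U : Fin t → Matrix.unitaryGroup (BasisAB p dB) ℂ) : ℝ :=
  if x % p = y % p then 0 else overlap p t dB y x U

/-- The error budget `δ` splits as `3δ / 4` for primes that separate `x` from `y` and `δ / 4` for
the at most `n / 8 ≤ δ |P| / 4` others, whose overlap is bounded by 1. -/
lemma mem_goodUnitaries {n : ℕ} {δ ε : ℝ} (hn : 0 < n) (hδ : 0 < δ) (hε0 : 0 < ε) (hε : ε < 1 / 4)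
    {P : Finset ℕ} {t dB : ℕ} (ht : 0 < t) (hdB : 0 < dB)
    (hP : ∀ p ∈ P, p.Prime ∧ 256 ≤ p ∧ p ≤ 2 ^ n) (hcard : (n : ℝ) / (2 * δ) ≤ P.card)
    {U : UnitaryFamily P t dB} (hU : ∀ p : P, LocksWell p.1 t dB (ε / 4) (U p))
    (hover : ∀ x y : Fin (2 ^ n), x ≠ y →
      ∑ p : P, cleanOverlap p.1 t dB y x (U p) ≤ 3 / 4 * δ * P.card) :
    U ∈ goodUnitaries n δ ε P t dB := by
  have hn' : (0 : ℝ) < n := by exact_mod_cast hn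
  have hcpos : (0 : ℝ) < P.card := lt_of_lt_of_le (by positivity) hcard
  have hPne : P.Nonempty := Finset.card_pos.1 (by exact_mod_cast hcpos)
  have hp0 : ∀ p ∈ P, 0 < p := fun p hp => (hP p hp).1.pos
  refine ⟨supportTest P t dB U, ?_, ?_, ?_, ?_, ?_⟩
  · exact fun x => fingerprint_isDensityOperator hp0 hPne ht hdB U x
  · exact fun y => supportTest_isBinaryMeasurement U y
  · intro x
    rw [outcomeProb_supportTest]
    simp only [fun p : P => overlap_self (hp0 p.1 p.2) ht hdB x (U p)]
    simp [hcpos.ne']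
  · intro x y hyx
    rw [outcomeProb_supportTest]
    let B : Finset ℕ := P.filter fun p => x.val % p = y.val % p
    have hB : 8 * B.card ≤ n := by
      refine card_primes_mod_eq_le x.2 y.2 (fun h => hyx (Fin.ext h.symm)) fun p hp => ?_
      obtain ⟨h1, h2⟩ := Finset.mem_filter.1 hp
      exact ⟨(hP p h1).1, (hP p h1).2.1, h2⟩
    have hB' : (B.card : ℝ) ≤ n / 8 := by
      have : (8 * B.card : ℝ) ≤ n := by exact_mod_cast hB
      linarith
    have hBsum : ∑ p : P, (if x.val % p.1 = y.val % p.1 then (1 : ℝ) else 0) = B.card := by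
      rw [Finset.sum_coe_sort P (fun p => if x.val % p = y.val % p then (1 : ℝ) else 0),
        Finset.sum_boole]
    have hle : ∑ p : P, overlap p.1 t dB y x (U p) ≤
        ∑ p : P, (cleanOverlap p.1 t dB y x (U p) +
          if x.val % p.1 = y.val % p.1 then (1 : ℝ) else 0) := by
      refine Finset.sum_le_sum fun p _ => ?_
      rw [cleanOverlap]
      split_ifs with h
      · rw [zero_add]; exact overlap_le_one (hp0 p.1 p.2) ht hdB _ _ _
      · rw [add_zero]
    rw [Finset.sum_add_distrib, hBsum] at hle
    have h1 := hover x y hyx.symm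
    have h2 : (n : ℝ) ≤ P.card * (2 * δ) := by rwa [div_le_iff₀ (by positivity)] at hcard
    rw [one_div, inv_mul_le_iff₀ hcpos]
    linarith
  · intro κ _ N hN i hne
    exact hides_of_locksWell hε0 hε P U (fun p hp => ⟨hp0 p hp, (hP p hp).2.2⟩) hU
      (hN.posSemidef i) hne

instance unitaryLaw_isProbabilityMeasure (P : Finset ℕ) (t dB : ℕ) :
    IsProbabilityMeasure (unitaryLaw P t dB) := by
  unfold unitaryLaw; infer_instance

lemma measure_not_locksWell_pi_le {P : Finset ℕ} {t dB : ℕ} (ht : 0 < t) (hdB : 0 < dB) {ε : ℝ}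
    (hε0 : 0 < ε) (hε : ε < 1 / 4) (htε : 16384 ≤ t * ε ^ 2) (p : P) (hp : 0 < p.1) :
    (unitaryLaw P t dB).real {U | ¬ LocksWell p.1 t dB (ε / 4) (U p)} ≤
      Real.exp (-(10 * p.1)) := by
  refine le_trans ?_ (measure_not_locksWell_le hp ht hdB hε0 hε htε)
  have hmp := measurePreserving_eval
    (fun p : P => Measure.pi fun _ : Fin t => haarUnitary (BasisAB p.1 dB)) p
  -- Measurability of this event is not established; the inequality for outer measures holds for
  -- every set.
  have h := Measure.le_map_apply (μ := unitaryLaw P t dB) hmp.measurable.aemeasurable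
    {V | ¬ LocksWell p.1 t dB (ε / 4) V}
  rw [unitaryLaw] at h ⊢
  rw [hmp.map_eq] at h
  exact ENNReal.toReal_mono (measure_ne_top _ _) h

/-- Chernoff with `lam = 16`: means of at most `4 δ / exp 16` contribute `4 δ |P|` to the exponent,
against `16 · (3 / 4) δ |P| = 12 δ |P|` from the threshold. -/
lemma measure_cleanOverlap_gt_le {P : Finset ℕ} {t dB : ℕ} (ht : 0 < t) (hdB : 0 < dB) {δ : ℝ}
    (hP : ∀ p ∈ P, 1 < p) (hδ : 0 < δ)
    (hPt : ∀ p ∈ P, (t : ℝ) / (p - 1) ≤ 4 * δ / Real.exp 16) (y x : ℕ) :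
    (unitaryLaw P t dB).real
      {U | ¬ ∑ p : P, cleanOverlap p.1 t dB y x (U p) ≤ 3 / 4 * δ * P.card} ≤
      Real.exp (-(8 * δ * P.card)) := by
  have hp0 : ∀ p ∈ P, 0 < p := fun p hp => lt_trans one_pos (hP p hp)
  have h := measure_sum_ge_le
    (fun p : P => Measure.pi fun _ : Fin t => haarUnitary (BasisAB p.1 dB))
    (X := fun p U => cleanOverlap p.1 t dB y x U)
    (fun p => by
      unfold cleanOverlap
      split_ifs
      · exact measurable_const
      · exact measurable_overlap (hp0 p.1 p.2) ht hdB y x)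
    (fun p U => by
      unfold cleanOverlap
      split_ifs
      · exact le_rfl
      · exact overlap_nonneg y x U)
    (fun p U => by
      unfold cleanOverlap
      split_ifs
      · exact zero_le_one
      · exact overlap_le_one (hp0 p.1 p.2) ht hdB y x U)
    (m := 4 * δ / Real.exp 16) (lam := 16)
    (fun p => by
      unfold cleanOverlap
      split_ifs with hxy
      · rw [integral_zero]; positivity
      · exact (integral_overlap_le (hP p.1 p.2) ht hdB hxy).trans (hPt p.1 p.2))
    (by norm_num) (3 / 4 * δ * P.card)
  refine (measureReal_mono (fun U hU => (not_le.1 hU).le) (measure_ne_top _ _)).trans (h.trans ?_)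
  rw [Real.exp_le_exp, Fintype.card_coe]
  have : Real.exp 16 * (4 * δ / Real.exp 16) = 4 * δ := by
    field_simp
  rw [this]
  apply le_of_eq
  ring

/-- The failure probability for a set of primes with the required properties. -/
lemma measure_compl_goodUnitaries_le {n : ℕ} {δ ε : ℝ} (hn : 0 < n) (hδ : 0 < δ) (hε0 : 0 < ε)
    (hε : ε < 1 / 4) {P : Finset ℕ} {t dB : ℕ} (ht : 0 < t) (hdB : 0 < dB)
    (htε : 16384 ≤ t * ε ^ 2) (hP : ∀ p ∈ P, p.Prime ∧ 256 ≤ p ∧ p ≤ 2 ^ n ∧ 10 * n ≤ p)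
    (hPt : ∀ p ∈ P, (t : ℝ) / (p - 1) ≤ 4 * δ / Real.exp 16)
    (hPcard : P.card ≤ 2 ^ n) (hcard : (n : ℝ) / (2 * δ) ≤ P.card) :
    (unitaryLaw P t dB).real (goodUnitaries n δ ε P t dB)ᶜ ≤ (1 / 2) ^ n := by
  set ν := unitaryLaw P t dB with hν
  let bad₁ : P → Set (UnitaryFamily P t dB) := fun p => {U | ¬ LocksWell p.1 t dB (ε / 4) (U p)}
  let bad₂ : Fin (2 ^ n) × Fin (2 ^ n) → Set (UnitaryFamily P t dB) := fun q =>
    {U | ¬ ∑ p : P, cleanOverlap p.1 t dB q.2 q.1 (U p) ≤ 3 / 4 * δ * P.card}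
  have hsub : (goodUnitaries n δ ε P t dB)ᶜ ⊆ (⋃ p, bad₁ p) ∪ ⋃ q, bad₂ q := by
    intro U hU
    by_contra hcon
    simp only [Set.mem_union, Set.mem_iUnion, not_or, not_exists] at hcon
    refine hU (mem_goodUnitaries hn hδ hε0 hε ht hdB
      (fun p hp => ⟨(hP p hp).1, (hP p hp).2.1, (hP p hp).2.2.1⟩) hcard
      (fun p => not_not.1 (hcon.1 p)) fun x y _ => not_not.1 (hcon.2 (x, y)))
  have hq : Real.exp (-(n : ℝ)) ≤ (1 / 2) ^ n := by
    have h1 : Real.exp (-(n : ℝ)) = Real.exp (-1) ^ n := by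
      rw [← Real.exp_nat_mul]; congr 1; ring
    rw [h1]
    have h2 : Real.exp (-1) ≤ 1 / 2 := by
      rw [Real.exp_neg, one_div]
      apply inv_anti₀ (by norm_num)
      linarith [Real.exp_one_gt_d9]
    gcongr
  set q : ℝ := (1 / 2) ^ n with hqdef
  have hq0 : 0 < q := by positivity
  have hqhalf : q ≤ 1 / 2 := by
    calc q ≤ (1 / 2) ^ 1 := pow_le_pow_of_le_one (by norm_num) (by norm_num) hn
      _ = 1 / 2 := pow_one _
  have hq2 : (2 : ℝ) ^ n = q⁻¹ := by rw [hqdef]; simp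
  have hexp4 : Real.exp (-(4 * n : ℝ)) ≤ q ^ 4 := by
    have : Real.exp (-(4 * n : ℝ)) = Real.exp (-(n : ℝ)) ^ 4 := by
      rw [← Real.exp_nat_mul]; congr 1; push_cast; ring
    rw [this]
    gcongr
  -- Every single bad event has probability at most `q ^ 4`: here because `p ≥ 10 n`, and in `hb2`
  -- because `8 δ |P| ≥ 4 n`. The unions have at most `q⁻¹` and `q⁻²` members.
  have hb1 : ν.real (⋃ p, bad₁ p) ≤ q ^ 3 := by
    calc ν.real (⋃ p, bad₁ p) ≤ ∑ p, ν.real (bad₁ p) := measureReal_iUnion_fintype_le _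
      _ ≤ ∑ _p : P, q ^ 4 := by
          refine Finset.sum_le_sum fun p _ => ?_
          obtain ⟨-, hp2, -, hp4⟩ := hP p.1 p.2
          refine (measure_not_locksWell_pi_le ht hdB hε0 hε htε p (by omega)).trans
            (le_trans ?_ hexp4)
          rw [Real.exp_le_exp, neg_le_neg_iff]
          have : (10 * n : ℝ) ≤ p.1 := by exact_mod_cast hp4
          have hn0 : (0 : ℝ) ≤ n := Nat.cast_nonneg n
          linarith
      _ = P.card * q ^ 4 := by simp
      _ ≤ q⁻¹ * q ^ 4 := by
          rw [← hq2]
          gcongr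
          exact_mod_cast hPcard
      _ = q ^ 3 := by field_simp
  have hb2 : ν.real (⋃ z, bad₂ z) ≤ q ^ 2 := by
    calc ν.real (⋃ z, bad₂ z) ≤ ∑ z, ν.real (bad₂ z) := measureReal_iUnion_fintype_le _
      _ ≤ ∑ _z : Fin (2 ^ n) × Fin (2 ^ n), q ^ 4 := by
          refine Finset.sum_le_sum fun z _ => ?_
          refine (measure_cleanOverlap_gt_le ht hdB (fun p hp => (hP p hp).1.one_lt) hδ hPt
            z.2 z.1).trans (le_trans ?_ hexp4)
          rw [Real.exp_le_exp, neg_le_neg_iff]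
          rw [div_le_iff₀ (by positivity)] at hcard
          linarith
      _ = 2 ^ n * 2 ^ n * q ^ 4 := by
          rw [Finset.sum_const, Finset.card_univ, Fintype.card_prod, Fintype.card_fin,
            nsmul_eq_mul]
          push_cast
          ring
      _ = q ^ 2 := by rw [hq2]; field_simp
  calc ν.real (goodUnitaries n δ ε P t dB)ᶜ ≤ ν.real ((⋃ p, bad₁ p) ∪ ⋃ z, bad₂ z) :=
        measureReal_mono hsub (measure_ne_top _ _)
    _ ≤ ν.real (⋃ p, bad₁ p) + ν.real (⋃ z, bad₂ z) := measureReal_union_le _ _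
    _ ≤ q ^ 3 + q ^ 2 := add_le_add hb1 hb2
    _ ≤ q := by nlinarith [mul_pos hq0 hq0]

end Scheme

/-! ### The parameters -/

section Parameters

lemma two_le_logb_one_div {ε : ℝ} (hε0 : 0 < ε) (hε : ε < 1 / 4) : 2 ≤ Real.logb 2 (1 / ε) := by
  rw [Real.le_logb_iff_rpow_le (by norm_num) (by positivity), le_div_iff₀ hε0]
  norm_num
  linarith

/-- The base of the power is at least 1, so the exponent `1 / 0.9` only enlarges it. What remains is
proportional to `t / δ`, the scale on which primes must exceed `t` for small mean overlaps. -/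
lemma mul_le_lowerEnd {n : ℕ} {C δ ε : ℝ} (hC : 10 ^ 12 ≤ C) (hδ0 : 0 < δ) (hδ : δ < 1 / 4) (hε0 : 0 < ε)
    (hε : ε < 1 / 4) :
    C / δ * (Real.logb 2 (1 / ε) / ε ^ 2) + 10 * n ≤ lowerEnd C n δ ε := by
  have hL := two_le_logb_one_div hε0 hε
  set L := Real.logb 2 (1 / ε) with hLdef
  have h1 : L / ε ^ 2 ≤ L ^ 2 / ε ^ 8 := by
    rw [div_le_div_iff₀ (by positivity) (by positivity)]
    have h2 : ε ^ 8 ≤ ε ^ 2 := pow_le_pow_of_le_one hε0.le (by linarith) (by norm_num)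
    have h3 : L ≤ L ^ 2 := by nlinarith
    exact mul_le_mul h3 h2 (by positivity) (by positivity)
  have h4 : 1 ≤ L / ε ^ 2 := by
    rw [le_div_iff₀ (by positivity)]
    nlinarith
  have hC0 : 0 < C := by linarith
  have h5 : (1 : ℝ) ≤ C / δ := by
    rw [le_div_iff₀ hδ0]; linarith
  have h6 : C / δ * (L / ε ^ 2) ≤ C / δ * (L ^ 2 / ε ^ 8) := by gcongr
  have h7 : 1 ≤ C / δ * (L ^ 2 / ε ^ 8) := by
    refine le_trans ?_ h6
    nlinarith
  have h8 : C / δ * (L ^ 2 / ε ^ 8) ≤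
      (C / δ * (L ^ 2 / ε ^ 8)) ^ (1 / 0.9 : ℝ) := by
    calc C / δ * (L ^ 2 / ε ^ 8) = (C / δ * (L ^ 2 / ε ^ 8)) ^ (1 : ℝ) :=
          (Real.rpow_one _).symm
      _ ≤ _ := Real.rpow_le_rpow_of_exponent_le h7 (by norm_num)
  rw [lowerEnd]
  linarith

lemma failureProb_le {n : ℕ} {C δ ε : ℝ} (hC : 10 ^ 12 ≤ C) (hn : 0 < n) (hδ0 : 0 < δ) (hδ : δ < 1 / 4) (hε0 : 0 < ε)
    (hε : ε < 1 / 4) (hu : upperEnd C n δ ε ≤ (2 : ℝ) ^ ((n : ℝ) - 2))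
    (hcard : (n : ℝ) / (2 * δ) ≤ ((schemePrimes C n δ ε).card : ℝ)) :
    failureProb 8192 1 C n δ ε ≤ ENNReal.ofReal ((2 : ℝ) ^ (-(1 * (n : ℝ)))) := by
  have hL := two_le_logb_one_div hε0 hε
  have hl := mul_le_lowerEnd (n := n) hC hδ0 hδ hε0 hε
  set L := Real.logb 2 (1 / ε) with hLdef
  set l := lowerEnd C n δ ε with hldef
  set P := schemePrimes C n δ ε with hPdef
  set t := numUnitaries 8192 ε with htdef
  set dB := dimB 1 ε with hdBdef
  have hn0 : (0 : ℝ) ≤ n := Nat.cast_nonneg n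
  have hε2 : ε ^ 2 ≤ 1 := by nlinarith
  have hLε : 2 ≤ L / ε ^ 2 := by
    rw [le_div_iff₀ (by positivity)]; nlinarith
  have ht1 : 8192 * L / ε ^ 2 ≤ t := Nat.le_ceil _
  have ht2 : (t : ℝ) < 8192 * L / ε ^ 2 + 1 := Nat.ceil_lt_add_one (by positivity)
  have ht0 : 0 < t := Nat.ceil_pos.2 (by positivity)
  have hdB0 : 0 < dB := Nat.ceil_pos.2 (by positivity)
  have htε : 16384 ≤ t * ε ^ 2 := by
    rw [div_le_iff₀ (by positivity)] at ht1
    linarith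
  set A := C / δ * (L / ε ^ 2) with hA
  have hAbig : 2 * 10 ^ 12 ≤ A := by
    have : (10 : ℝ) ^ 12 ≤ C / δ := by
      rw [le_div_iff₀ hδ0]; nlinarith
    calc (2 : ℝ) * 10 ^ 12 = 10 ^ 12 * 2 := by ring
      _ ≤ C / δ * (L / ε ^ 2) := by gcongr
  have hPmem : ∀ p ∈ P, p.Prime ∧ l ≤ p ∧ (p : ℝ) ≤ upperEnd C n δ ε := fun p hp =>
    (Finset.mem_filter.1 hp).2
  have hpow : (2 : ℝ) ^ ((n : ℝ) - 2) = 2 ^ n / 4 := by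
    rw [Real.rpow_sub (by norm_num), Real.rpow_natCast]; norm_num
  rw [hpow] at hu
  have h2n : (0 : ℝ) < 2 ^ n := by positivity
  have he16 : Real.exp 16 ≤ 3 ^ 16 := by
    have : Real.exp 16 = Real.exp 1 ^ 16 := by rw [← Real.exp_nat_mul]; norm_num
    rw [this]
    have := Real.exp_one_lt_d9
    gcongr
    linarith
  have key := measure_compl_goodUnitaries_le hn hδ0 hε0 hε (P := P) ht0 hdB0 htε
    (fun p hp => by
      obtain ⟨h1, h2, h3⟩ := hPmem p hp
      refine ⟨h1, ?_, ?_, ?_⟩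
      · have : (256 : ℝ) ≤ p := by linarith
        exact_mod_cast this
      · have : (p : ℝ) ≤ 2 ^ n := by linarith
        exact_mod_cast this
      · have : (10 * n : ℝ) ≤ p := by linarith
        exact_mod_cast this)
    (fun p hp => by
      obtain ⟨h1, h2, h3⟩ := hPmem p hp
      have hpA : A / 2 ≤ p - 1 := by linarith
      rw [div_le_div_iff₀ (by linarith) (Real.exp_pos _)]
      have h4 : (t : ℝ) ≤ 8193 * (L / ε ^ 2) := by
        rw [mul_div_assoc] at ht2; linarith
      have h5 : A * δ = C * (L / ε ^ 2) := by rw [hA]; field_simp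
      calc (t : ℝ) * Real.exp 16 ≤ 8193 * (L / ε ^ 2) * 3 ^ 16 := by gcongr
        _ = 8193 * 3 ^ 16 * (L / ε ^ 2) := by ring
        _ ≤ 2 * C * (L / ε ^ 2) :=
          mul_le_mul_of_nonneg_right (by norm_num; linarith) (by positivity)
        _ = 2 * (C * (L / ε ^ 2)) := by ring
        _ = 4 * δ * (A / 2) := by rw [← h5]; ring
        _ ≤ 4 * δ * (p - 1) := by gcongr)
    (by
      have h1 : P.card ≤ ⌊upperEnd C n δ ε⌋₊ + 1 :=
        (Finset.card_filter_le _ _).trans (by simp)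
      have h2 : (1 : ℝ) ≤ 2 ^ n := one_le_pow₀ (by norm_num)
      have hu0 : 0 ≤ upperEnd C n δ ε := by
        have : 0 ≤ ((n : ℝ) / (2 * δ)) ^ 2 := sq_nonneg _
        rw [upperEnd, ← hldef]; linarith
      have h3 : (⌊upperEnd C n δ ε⌋₊ : ℝ) ≤ 2 ^ n / 4 := (Nat.floor_le hu0).trans hu
      have h4 : (P.card : ℝ) ≤ ⌊upperEnd C n δ ε⌋₊ + 1 := by exact_mod_cast h1
      have h5 : (2 : ℝ) ≤ 2 ^ n := by
        calc (2 : ℝ) = 2 ^ 1 := (pow_one _).symm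
          _ ≤ 2 ^ n := pow_le_pow_right₀ (by norm_num) hn
      have : (P.card : ℝ) ≤ 2 ^ n := by linarith
      exact_mod_cast this) hcard
  rw [failureProb, ← ofReal_measureReal (measure_ne_top _ _)]
  refine ENNReal.ofReal_le_ofReal (key.trans (le_of_eq ?_))
  rw [one_mul, Real.rpow_neg (by norm_num), Real.rpow_natCast]
  simp

lemma le_card_schemePrimes {n : ℕ} {C δ ε : ℝ} (hC : 10 ^ 12 ≤ C) (hδ0 : 0 < δ) (hδ : δ < 1 / 4) (hε0 : 0 < ε)
    (hε : ε < 1 / 4) (hl : lowerEnd C n δ ε ≤ ((n : ℝ) / (2 * δ)) ^ 2) :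
    (n : ℝ) / (2 * δ) ≤ ((schemePrimes C n δ ε).card : ℝ) := by
  have hL := two_le_logb_one_div hε0 hε
  have h1 := mul_le_lowerEnd (n := n) hC hδ0 hδ hε0 hε
  have hLε : 1 ≤ Real.logb 2 (1 / ε) / ε ^ 2 := by
    rw [le_div_iff₀ (by positivity)]; nlinarith
  have h2 : (10 : ℝ) ^ 12 ≤ C / δ := by
    rw [le_div_iff₀ hδ0]; nlinarith
  have h3 : (10 : ℝ) ^ 12 ≤ C / δ * (Real.logb 2 (1 / ε) / ε ^ 2) := by
    calc (10 : ℝ) ^ 12 = 10 ^ 12 * 1 := (mul_one _).symm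
      _ ≤ _ := by gcongr
  have hn0 : (0 : ℝ) ≤ n := Nat.cast_nonneg n
  have h := sqrt_le_card_primesBetween (l := lowerEnd C n δ ε)
    (m := ((n : ℝ) / (2 * δ)) ^ 2) (by linarith) hl
  rwa [Real.sqrt_sq (by positivity)] at h

/-- For fixed `δ` and `ε` the parameters are admissible for all large `n`. -/
lemma eventually_parameters (c'' : ℝ) {δ : ℝ} (ε : ℝ) (hδ0 : 0 < δ) (hδ : δ < 1 / 4) :
    ∃ N : ℕ, ∀ n : ℕ, N ≤ n → 0 < n ∧ upperEnd c'' n δ ε ≤ (2 : ℝ) ^ ((n : ℝ) - 2) ∧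
      lowerEnd c'' n δ ε ≤ ((n : ℝ) / (2 * δ)) ^ 2 := by
  set A := (c'' / δ * (Real.logb 2 (1 / ε) ^ 2 / ε ^ 8)) ^ (1 / 0.9 : ℝ) with hA
  set b := (1 / (2 * δ)) ^ 2 with hb
  -- The upper end is at most a constant times `n ^ 2`, hence at most `n ^ 3` for large `n`;
  -- eventually `n ^ 3 ≤ 2 ^ n / 4`.
  have hlit := isLittleO_pow_const_const_pow_of_one_lt (R := ℝ) 3 (r := 2) (by norm_num)
  have hev := hlit.def (show (0 : ℝ) < 1 / 4 by norm_num)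
  obtain ⟨N₁, hN₁⟩ := Filter.eventually_atTop.1 hev
  refine ⟨max N₁ (max 1 ⌈|A| + 10 + b⌉₊), fun n hn => ?_⟩
  have hn1 : N₁ ≤ n := (le_max_left _ _).trans hn
  have hn2 : 1 ≤ n := (le_max_left _ _).trans ((le_max_right _ _).trans hn)
  have hn3 : |A| + 10 + b ≤ n :=
    (Nat.le_ceil _).trans (by
      exact_mod_cast (le_max_right _ _).trans ((le_max_right _ _).trans hn))
  have hn2' : (1 : ℝ) ≤ n := by exact_mod_cast hn2
  have h3 := hN₁ n hn1
  rw [Real.norm_of_nonneg (by positivity), Real.norm_of_nonneg (by positivity)] at h3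
  have hsq : ((n : ℝ) / (2 * δ)) ^ 2 = b * n ^ 2 := by rw [hb]; field_simp
  have hb4 : 4 ≤ b := by
    have : 2 ≤ 1 / (2 * δ) := by rw [le_div_iff₀ (by positivity)]; linarith
    rw [hb]; nlinarith
  have hAn : A ≤ |A| * n := by
    have := le_abs_self A
    nlinarith [abs_nonneg A]
  have hb0 : 0 ≤ b := by linarith
  have hlow : lowerEnd c'' n δ ε ≤ (|A| + 10) * n := by
    rw [lowerEnd, ← hA]; linarith
  have hpow : (2 : ℝ) ^ ((n : ℝ) - 2) = 2 ^ n / 4 := by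
    rw [Real.rpow_sub (by norm_num), Real.rpow_natCast]; norm_num
  have hlow2 : (|A| + 10) * n ≤ (|A| + 10) * n ^ 2 := by
    have := abs_nonneg A
    gcongr
    nlinarith
  refine ⟨hn2, ?_, ?_⟩
  · rw [upperEnd, hsq, hpow]
    have : (|A| + 10 + b) * n ^ 2 ≤ n * (n : ℝ) ^ 2 := by gcongr
    have h5 : (n : ℝ) * n ^ 2 = n ^ 3 := by ring
    linarith
  · rw [hsq]
    have : (|A| + 10) * n ≤ n * (n : ℝ) := by gcongr; linarith
    nlinarith

end Parameters

end HidingFingerprint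

end

theorem mainTheorem10 :
    ∃ c c' c'' κ : ℝ, 0 < c ∧ 0 < c' ∧ 0 < c'' ∧ 0 < κ ∧
      (∀ (n : ℕ) (δ ε : ℝ), 0 < n → 0 < δ → δ < 1 / 4 → 0 < ε → ε < 1 / 4 →
        HidingFingerprint.upperEnd c'' n δ ε ≤ (2 : ℝ) ^ ((n : ℝ) - 2) →
        ((n : ℝ) / (2 * δ) ≤ ((HidingFingerprint.schemePrimes c'' n δ ε).card : ℝ) ∨
          HidingFingerprint.lowerEnd c'' n δ ε ≤ ((n : ℝ) / (2 * δ)) ^ 2) →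
        HidingFingerprint.failureProb c c' c'' n δ ε ≤
          ENNReal.ofReal ((2 : ℝ) ^ (-(κ * (n : ℝ))))) ∧
      (∀ δ ε : ℝ, 0 < δ → δ < 1 / 4 → 0 < ε → ε < 1 / 4 →
        ∃ N : ℕ, ∀ n : ℕ, N ≤ n →
          HidingFingerprint.upperEnd c'' n δ ε ≤ (2 : ℝ) ^ ((n : ℝ) - 2) ∧
          (n : ℝ) / (2 * δ) ≤ ((HidingFingerprint.schemePrimes c'' n δ ε).card : ℝ) ∧
          HidingFingerprint.failureProb c c' c'' n δ ε ≤
            ENNReal.ofReal ((2 : ℝ) ^ (-(κ * (n : ℝ))))) := by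
  -- As `log (1 / ε) ≥ 2`, the constant 8192 gives `t ε² ≥ 16384`. For `c''` the mean overlaps
  -- require `8193 · 3 ^ 16 ≤ 2 c''`, where `3 ^ 16` bounds `exp 16`. Of the dimension of `B` only
  -- positivity is needed.
  refine ⟨8192, 1, 10 ^ 12, 1, by norm_num, by norm_num, by norm_num, by norm_num, ?_, ?_⟩
  · intro n δ ε hn hδ0 hδ hε0 hε hu hor
    refine HidingFingerprint.failureProb_le le_rfl hn hδ0 hδ hε0 hε hu ?_
    rcases hor with h | h
    · exact h
    · exact HidingFingerprint.le_card_schemePrimes le_rfl hδ0 hδ hε0 hε h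
  · intro δ ε hδ0 hδ hε0 hε
    obtain ⟨N, hN⟩ := HidingFingerprint.eventually_parameters (10 ^ 12) ε hδ0 hδ
    refine ⟨N, fun n hn => ?_⟩
    obtain ⟨hn0, hu, hl⟩ := hN n hn
    have hcard := HidingFingerprint.le_card_schemePrimes le_rfl hδ0 hδ hε0 hε hl
    exact ⟨hu, hcard, HidingFingerprint.failureProb_le le_rfl hn0 hδ0 hδ hε0 hε hu hcard⟩
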